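/- **Notation.** Let $\mathbb{H}$ be the real quaternions and $\mathbb{H}[z]$ the ring of polynomials in a variable $z$ that commutes with the coefficients. For $f=\sum_k z^kf_k\in\mathbb{H}[z]$ and $\alpha\in\mathbb{H}$ put $f^{e_\ell}(\alpha)=\sum_k\alpha^kf_k$, $f^{e_r}(\alpha)=\sum_k f_k\alpha^k$ and $f^\sharp=\sum_k z^k\overline{f_k}$. The polynomial $f^\sharp f$ has real coefficients, so it has a single value $(f^\sharp f)(\alpha)$. Write $\alpha\sim\beta$ if $\alpha=h^{-1}\beta h$ for some $h\ne0$. For a finite set $S\subset\mathbb{H}$ let $P_{S,\ell}$ (resp. $P_{S,r}$) be the unique monic generator of the right ideal $\{f: f^{e_\ell}|_S=0\}$ (resp. of the left ideal $\{f: f^{e_r}|_S=0\}$). For equivalent non-real $\alpha=x+yI$, $\beta=x+y\tilde I$ ($x\in\mathbb{R}$, $y>0$, $I^2=\tilde I^2=-1$) let $\Pi_{\alpha,\beta}$ be the real plane $\mathrm{span}\{1,I\}$ if $\beta=\alpha$, $(\mathrm{span}\{1,I\})^\perp$ (in $\mathbb{H}\cong\mathbb{R}^4$) if $\beta=\overline\alpha$,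 and $\mathrm{span}\{I+\tilde I,\,1-I\tilde I\}$ otherwise. **Data.** Let $\Lambda=\{\alpha_1,\dots,\alpha_n\}$ and $\Omega=\{\beta_1,\dots,\beta_m\}$ each consist of distinct quaternions ($n,m\ge0$; $\Lambda\cap\Omega$ may be non-empty), let $c_1,\dots,c_n,d_1,\dots,d_m\in\mathbb{H}$, and let $0\le k\le\min(n,m)$. Assume: 1. no three of the $n+m$ nodes $\alpha_1,\dots,\alpha_n,\beta_1,\dots,\beta_m$ are equivalent (a quaternion that occurs both as some $\alpha_i$ and as some $\beta_j$ counts as two nodes); 2. $\alpha_s\sim\beta_s$ for $1\le s\le k$; for $i>k$ no $\beta_j$ is equivalent to $\alpha_i$, and for $j>k$ no $\alpha_i$ is equivalent to $\beta_j$; 3. $\beta_s\notin\mathbb{R}$ for $1\le s\le k$; 4. $\overline{\alpha_s}(c_s-d_s)=(c_s-d_s)\beta_s$ for $1\le s\le k$. **Elementary polynomials.** Put $\Lambda_i=\Lambda\setminus\{\alpha_i\}$, $\Omega_j=\Omega\setminus\{\beta_j\}$. For $P,Q\in\mathbb{H}[z]$ let $$\rho(P,Q;\alpha,c)=P^{e_\ell}(\alpha)^{-1}\,(Q^\sharp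 Q)(\alpha)^{-1}\,c\;(Q^\sharp)^{e_\ell}(c^{-1}\alpha c)\ \ (c\ne0),\qquad \rho(P,Q;\alpha,0)=0,$$ $$\gamma(P,Q;\beta,d)=(P^\sharp)^{e_r}(d\beta d^{-1})\,d\,(P^\sharp P)(\beta)^{-1}\,Q^{e_r}(\beta)^{-1}\ \ (d\ne0),\qquad \gamma(P,Q;\beta,0)=0.$$ Define - $\tilde f_{\ell,i}=P_{\Lambda_i,\ell}\cdot\rho(P_{\Lambda_i,\ell},P_{\Omega,r};\alpha_i,c_i)\cdot P_{\Omega,r}$ for $k<i\le n$; - $\tilde f_{r,j}=P_{\Lambda,\ell}\cdot\gamma(P_{\Lambda,\ell},P_{\Omega_j,r};\beta_j,d_j)\cdot P_{\Omega_j,r}$ for $k<j\le m$; - for $1\le s\le k$: $\tilde\alpha_s=P_{\Lambda_s,\ell}^{e_\ell}(\alpha_s)^{-1}\alpha_sP_{\Lambda_s,\ell}^{e_\ell}(\alpha_s)$, $\tilde\beta_s=P_{\Omega_s,r}^{e_r}(\beta_s)\beta_sP_{\Omega_s,r}^{e_r}(\beta_s)^{-1}$, $\rho_s=\rho(P_{\Lambda_s,\ell},P_{\Omega_s,r};\alpha_s,c_s)$,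 $\gamma_s=\gamma(P_{\Lambda_s,\ell},P_{\Omega_s,r};\beta_s,d_s)$ and $$\tilde f_s=P_{\Lambda_s,\ell}\cdot\rho_s\cdot P_{\Omega_s,r}+P_{\Lambda,\ell}\cdot(2\,\mathrm{Im}\,\tilde\alpha_s)^{-1}(\rho_s-\gamma_s)\cdot P_{\Omega_s,r}.$$ **Theorem.** A polynomial $f\in\mathbb{H}[z]$ satisfies $f^{e_\ell}(\alpha_i)=c_i$ for all $1\le i\le n$ and $f^{e_r}(\beta_j)=d_j$ for all $1\le j\le m$ if and only if $$f=\sum_{i=k+1}^n\tilde f_{\ell,i}+\sum_{j=k+1}^m\tilde f_{r,j}+\sum_{s=1}^k\tilde f_s+\sum_{s=1}^kP_{\Lambda_s,\ell}\cdot\mu_s\cdot P_{\Omega,r}+P_{\Lambda,\ell}\cdot h\cdot P_{\Omega,r}$$ for some $\mu_s\in\Pi_{\tilde\alpha_s,\tilde\beta_s}$ ($1\le s\le k$) and some $h\in\mathbb{H}[z]$. -/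

import Mathlib

open scoped Quaternion Polynomial

namespace QuatInterp

noncomputable section

/-! Quaternionic polynomials are elements of `Polynomial ℍ[ℝ]`: the variable commutes with the
coefficients. -/

/-- Left evaluation: `∑ αᵏ fₖ`. -/
def evalL (f : Polynomial ℍ[ℝ]) (a : ℍ[ℝ]) : ℍ[ℝ] := f.sum fun k q => a ^ k * q

/-- Right evaluation: `∑ fₖ αᵏ`. -/
def evalR (f : Polynomial ℍ[ℝ]) (a : ℍ[ℝ]) : ℍ[ℝ] := f.sum fun k q => q * a ^ k

/-- Conjugate polynomial: all coefficients are replaced by their quaternionic conjugates. -/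
def conjPoly (f : Polynomial ℍ[ℝ]) : Polynomial ℍ[ℝ] :=
  f.sum fun k q => Polynomial.monomial k (star q)

/-- `P` is a left minimal polynomial of `Λ`: it is monic and it generates the right ideal of all
polynomials that vanish on `Λ` under left evaluation. -/
def IsLmp (Λ : Set ℍ[ℝ]) (P : Polynomial ℍ[ℝ]) : Prop :=
  P.Monic ∧ ∀ f : Polynomial ℍ[ℝ], (∀ a ∈ Λ, evalL f a = 0) ↔ ∃ g, f = P * g

/-- `P` is a right minimal polynomial of `Ω`: it is monic and it generates the left ideal of all
polynomials that vanish on `Ω` under right evaluation. -/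
def IsRmp (Ω : Set ℍ[ℝ]) (P : Polynomial ℍ[ℝ]) : Prop :=
  P.Monic ∧ ∀ f : Polynomial ℍ[ℝ], (∀ b ∈ Ω, evalR f b = 0) ↔ ∃ g, f = g * P

open Classical in
/-- The left minimal polynomial of `Λ` (zero when the ideal of `Λ` has no monic generator, which
does not happen for a finite set, see `isLmp_lmp`). -/
def lmp (Λ : Set ℍ[ℝ]) : Polynomial ℍ[ℝ] := if h : ∃ P, IsLmp Λ P then h.choose else 0

open Classical in
/-- The right minimal polynomial of `Ω` (zero when the ideal of `Ω` has no monic generator, which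
does not happen for a finite set, see `isRmp_rmp`). -/
def rmp (Ω : Set ℍ[ℝ]) : Polynomial ℍ[ℝ] := if h : ∃ P, IsRmp Ω P then h.choose else 0

/-! Existence and uniqueness of the minimal polynomials of finite sets. -/

theorem evalL_add (f g : Polynomial ℍ[ℝ]) (a : ℍ[ℝ]) :
    evalL (f + g) a = evalL f a + evalL g a :=
  Polynomial.sum_add_index f g _ (by simp) (by simp [mul_add])

theorem evalL_monomial (k : ℕ) (q a : ℍ[ℝ]) :
    evalL (Polynomial.monomial k q) a = a ^ k * q :=
  Polynomial.sum_monomial_index _ _ (by simp)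

theorem evalL_zero (a : ℍ[ℝ]) : evalL 0 a = 0 := by simp [evalL]

theorem evalL_mul (P g : Polynomial ℍ[ℝ]) (a : ℍ[ℝ]) :
    evalL (P * g) a = g.sum fun k q => a ^ k * evalL P a * q := by
  induction g using Polynomial.induction_on' with
  | add g₁ g₂ h₁ h₂ =>
    rw [mul_add, evalL_add, h₁, h₂,
      Polynomial.sum_add_index g₁ g₂ _ (by simp) (by simp [mul_add])]
  | monomial k q =>
    rw [Polynomial.sum_monomial_index _ _ (by simp)]
    induction P using Polynomial.induction_on' with
    | add P₁ P₂ h₁ h₂ => rw [add_mul, evalL_add, h₁, h₂, evalL_add, mul_add, add_mul]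
    | monomial j p =>
      rw [Polynomial.monomial_mul_monomial, evalL_monomial, evalL_monomial, add_comm j k, pow_add]
      simp only [mul_assoc]

theorem evalL_mul_of_eq_zero {P : Polynomial ℍ[ℝ]} (g : Polynomial ℍ[ℝ]) {a : ℍ[ℝ]}
    (h : evalL P a = 0) : evalL (P * g) a = 0 := by
  rw [evalL_mul, h]; simp [Polynomial.sum_def]

theorem evalL_mul_of_ne_zero {P : Polynomial ℍ[ℝ]} (g : Polynomial ℍ[ℝ]) {a : ℍ[ℝ]}
    (h : evalL P a ≠ 0) :
    evalL (P * g) a = evalL P a * evalL g ((evalL P a)⁻¹ * a * evalL P a) := by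
  have key : ∀ k : ℕ, evalL P a * ((evalL P a)⁻¹ * a * evalL P a) ^ k = a ^ k * evalL P a := by
    intro k
    induction k with
    | zero => simp
    | succ k ih =>
      rw [pow_succ, ← mul_assoc, ih, pow_succ]
      simp only [← mul_assoc]
      rw [mul_assoc (a ^ k) (evalL P a), mul_inv_cancel₀ h, mul_one]
  rw [evalL_mul, evalL.eq_1 g, Polynomial.sum_def, Polynomial.sum_def, Finset.mul_sum]
  exact Finset.sum_congr rfl fun k _ => by rw [← mul_assoc, key]

theorem evalL_X_sub_C (b a : ℍ[ℝ]) : evalL (Polynomial.X - Polynomial.C b) a = a - b := by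
  have : (Polynomial.X - Polynomial.C b : Polynomial ℍ[ℝ])
      = Polynomial.monomial 1 1 + Polynomial.monomial 0 (-b) := by
    rw [Polynomial.monomial_zero_left, Polynomial.C_neg, sub_eq_add_neg, Polynomial.X]
  rw [this, evalL_add, evalL_monomial, evalL_monomial]
  simp [sub_eq_add_neg]

theorem evalL_eq_zero_iff (f : Polynomial ℍ[ℝ]) (a : ℍ[ℝ]) :
    evalL f a = 0 ↔ ∃ g, f = (Polynomial.X - Polynomial.C a) * g := by
  constructor
  · intro h
    have hm : (Polynomial.X - Polynomial.C a).Monic := Polynomial.monic_X_sub_C a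
    have e := Polynomial.modByMonic_add_div f (Polynomial.X - Polynomial.C a)
    have hd : (f %ₘ (Polynomial.X - Polynomial.C a)).degree < 1 := by
      simpa using Polynomial.degree_modByMonic_lt f hm
    have hc := Polynomial.eq_C_of_degree_le_zero (Nat.WithBot.lt_one_iff_le_zero.mp hd)
    refine ⟨f /ₘ (Polynomial.X - Polynomial.C a), ?_⟩
    have h2 : evalL (f %ₘ (Polynomial.X - Polynomial.C a)) a = 0 := by
      rw [← e, evalL_add, evalL_mul_of_eq_zero _ (by rw [evalL_X_sub_C, sub_self]), add_zero] at h
      exact h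
    rw [hc, ← Polynomial.monomial_zero_left, evalL_monomial, pow_zero, one_mul] at h2
    rw [h2, Polynomial.C_0] at hc
    rw [hc, zero_add] at e
    exact e.symm
  · rintro ⟨g, rfl⟩
    exact evalL_mul_of_eq_zero _ (by rw [evalL_X_sub_C, sub_self])

theorem exists_isLmp {Λ : Set ℍ[ℝ]} (h : Λ.Finite) : ∃ P, IsLmp Λ P := by
  induction Λ, h using Set.Finite.induction_on with
  | empty => exact ⟨1, Polynomial.monic_one, fun f => by simp⟩
  | @insert a S _ _ ih =>
    obtain ⟨P, hP, hP'⟩ := ih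
    by_cases hu : evalL P a = 0
    · refine ⟨P, hP, fun f => ?_⟩
      rw [Set.forall_mem_insert, hP']
      refine ⟨fun h => h.2, ?_⟩
      rintro ⟨g, rfl⟩
      exact ⟨evalL_mul_of_eq_zero _ hu, g, rfl⟩
    · refine ⟨P * (Polynomial.X - Polynomial.C ((evalL P a)⁻¹ * a * evalL P a)),
        hP.mul (Polynomial.monic_X_sub_C _), fun f => ?_⟩
      rw [Set.forall_mem_insert, hP']
      constructor
      · rintro ⟨h, g, rfl⟩
        rw [evalL_mul_of_ne_zero _ hu, mul_eq_zero, or_iff_right hu, evalL_eq_zero_iff] at h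
        obtain ⟨q, rfl⟩ := h
        exact ⟨q, (mul_assoc _ _ _).symm⟩
      · rintro ⟨q, rfl⟩
        rw [mul_assoc]
        refine ⟨?_, _, rfl⟩
        rw [evalL_mul_of_ne_zero _ hu, (evalL_eq_zero_iff _ _).mpr ⟨q, rfl⟩, mul_zero]

theorem isLmp_lmp {Λ : Set ℍ[ℝ]} (h : Λ.Finite) : IsLmp Λ (lmp Λ) := by
  rw [lmp, dif_pos (exists_isLmp h)]
  exact (exists_isLmp h).choose_spec

theorem coeff_conjPoly (f : Polynomial ℍ[ℝ]) (k : ℕ) :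
    (conjPoly f).coeff k = star (f.coeff k) := by
  rw [conjPoly, Polynomial.sum_def, Polynomial.finsetSum_coeff]
  simp only [Polynomial.coeff_monomial]
  by_cases h : f.coeff k = 0 <;> simp [h]

theorem conjPoly_conjPoly (f : Polynomial ℍ[ℝ]) : conjPoly (conjPoly f) = f := by
  ext1 k; rw [coeff_conjPoly, coeff_conjPoly, star_star]

theorem conjPoly_mul (f g : Polynomial ℍ[ℝ]) : conjPoly (f * g) = conjPoly g * conjPoly f := by
  ext1 k
  rw [coeff_conjPoly, Polynomial.coeff_mul, Polynomial.coeff_mul, star_sum,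
    ← Finset.Nat.sum_antidiagonal_swap]
  exact Finset.sum_congr rfl fun x _ => by simp [coeff_conjPoly]

theorem support_conjPoly (f : Polynomial ℍ[ℝ]) : (conjPoly f).support = f.support := by
  ext k; simp [coeff_conjPoly]

theorem Monic.conjPoly {f : Polynomial ℍ[ℝ]} (h : f.Monic) : (conjPoly f).Monic := by
  have hd : (QuatInterp.conjPoly f).natDegree = f.natDegree := by
    simp only [Polynomial.natDegree, Polynomial.degree, support_conjPoly]
  rw [Polynomial.Monic, Polynomial.leadingCoeff, hd, coeff_conjPoly, h.coeff_natDegree, star_one]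

theorem evalL_conjPoly (f : Polynomial ℍ[ℝ]) (a : ℍ[ℝ]) :
    evalL (conjPoly f) (star a) = star (evalR f a) := by
  rw [evalL, evalR, Polynomial.sum_def, Polynomial.sum_def, star_sum, support_conjPoly]
  exact Finset.sum_congr rfl fun k _ => by rw [coeff_conjPoly, star_mul, star_pow]

theorem exists_isRmp {Ω : Set ℍ[ℝ]} (h : Ω.Finite) : ∃ P, IsRmp Ω P := by
  obtain ⟨P, hP, hP'⟩ := exists_isLmp (h.image star)
  refine ⟨conjPoly P, Monic.conjPoly hP, fun f => ?_⟩
  have h1 : (∀ b ∈ Ω, evalR f b = 0) ↔ ∀ a ∈ star '' Ω, evalL (conjPoly f) a = 0 := by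
    simp only [Set.forall_mem_image, evalL_conjPoly, star_eq_zero]
  rw [h1, hP']
  constructor
  · rintro ⟨g, hg⟩
    exact ⟨conjPoly g, by rw [← conjPoly_mul, ← hg, conjPoly_conjPoly]⟩
  · rintro ⟨g, rfl⟩
    exact ⟨conjPoly g, by rw [conjPoly_mul, conjPoly_conjPoly]⟩

theorem isRmp_rmp {Ω : Set ℍ[ℝ]} (h : Ω.Finite) : IsRmp Ω (rmp Ω) := by
  rw [rmp, dif_pos (exists_isRmp h)]
  exact (exists_isRmp h).choose_spec

theorem IsLmp.unique {Λ : Set ℍ[ℝ]} {P Q : Polynomial ℍ[ℝ]} (hP : IsLmp Λ P) (hQ : IsLmp Λ Q) :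
    P = Q := by
  obtain ⟨g, hg⟩ := (hQ.2 P).mp ((hP.2 P).mpr ⟨1, (mul_one P).symm⟩)
  obtain ⟨h, hh⟩ := (hP.2 Q).mp ((hQ.2 Q).mpr ⟨1, (mul_one Q).symm⟩)
  have hgm : g.Monic := hQ.1.of_mul_monic_left (hg ▸ hP.1)
  have hhm : h.Monic := hP.1.of_mul_monic_left (hh ▸ hQ.1)
  have h1 : P.natDegree = Q.natDegree + g.natDegree := by
    conv_lhs => rw [hg]
    exact hQ.1.natDegree_mul hgm
  have h2 : Q.natDegree = P.natDegree + h.natDegree := by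
    conv_lhs => rw [hh]
    exact hP.1.natDegree_mul hhm
  rw [hg, Polynomial.eq_one_of_monic_natDegree_zero hgm (by omega), mul_one]

theorem IsRmp.unique {Ω : Set ℍ[ℝ]} {P Q : Polynomial ℍ[ℝ]} (hP : IsRmp Ω P) (hQ : IsRmp Ω Q) :
    P = Q := by
  obtain ⟨g, hg⟩ := (hQ.2 P).mp ((hP.2 P).mpr ⟨1, (one_mul P).symm⟩)
  obtain ⟨h, hh⟩ := (hP.2 Q).mp ((hQ.2 Q).mpr ⟨1, (one_mul Q).symm⟩)
  have hgm : g.Monic := hQ.1.of_mul_monic_right (hg ▸ hP.1)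
  have hhm : h.Monic := hP.1.of_mul_monic_right (hh ▸ hQ.1)
  have h1 : P.natDegree = g.natDegree + Q.natDegree := by
    conv_lhs => rw [hg]
    exact hgm.natDegree_mul hQ.1
  have h2 : Q.natDegree = h.natDegree + P.natDegree := by
    conv_lhs => rw [hh]
    exact hhm.natDegree_mul hP.1
  rw [hg, Polynomial.eq_one_of_monic_natDegree_zero hgm (by omega), one_mul]

/-! The planes and the elementary polynomials. -/

/-- The unit imaginary direction `I` of a non-real quaternion `α = x + y I`, `y > 0`. -/
def imUnit (a : ℍ[ℝ]) : ℍ[ℝ] := ‖a.im‖⁻¹ • a.im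

open Classical in
/-- The real plane `Π_{α,β}` attached to two equivalent non-real quaternions
`α = x + y I`, `β = x + y J`, `y > 0`. -/
def plane (a b : ℍ[ℝ]) : Submodule ℝ ℍ[ℝ] :=
  if b = a then Submodule.span ℝ {1, imUnit a}
  else if b = star a then (Submodule.span ℝ {1, imUnit a})ᗮ
  else Submodule.span ℝ {imUnit a + imUnit b, 1 - imUnit a * imUnit b}

open Classical in
/-- `γ = P^{♯,r}(d β d⁻¹) · d · ((P^♯ P)(β))⁻¹ · (Q^r(β))⁻¹` if `d ≠ 0`, and `γ = 0` if `d = 0`. -/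
def gammaCoeff (P Q : Polynomial ℍ[ℝ]) (b d : ℍ[ℝ]) : ℍ[ℝ] :=
  if d = 0 then 0
  else evalR (conjPoly P) (d * b * d⁻¹) * d * (evalR (conjPoly P * P) b)⁻¹ * (evalR Q b)⁻¹

open Classical in
/-- `ρ = (P^ℓ(α))⁻¹ · ((Q^♯ Q)(α))⁻¹ · c · Q^{♯,ℓ}(c⁻¹ α c)` if `c ≠ 0`, and `ρ = 0` if `c = 0`. -/
def rhoCoeff (P Q : Polynomial ℍ[ℝ]) (a c : ℍ[ℝ]) : ℍ[ℝ] :=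
  if c = 0 then 0
  else (evalL P a)⁻¹ * (evalL (conjPoly Q * Q) a)⁻¹ * c * evalL (conjPoly Q) (c⁻¹ * a * c)

/-- `α̃ = P_{Λ∖{α},ℓ}(α)⁻¹ · α · P_{Λ∖{α},ℓ}(α)`. -/
def tildeL (Λ : Set ℍ[ℝ]) (a : ℍ[ℝ]) : ℍ[ℝ] :=
  (evalL (lmp (Λ \ {a})) a)⁻¹ * a * evalL (lmp (Λ \ {a})) a

/-- `β̃ = P_{Ω∖{β},r}(β) · β · P_{Ω∖{β},r}(β)⁻¹`. -/
def tildeR (Ω : Set ℍ[ℝ]) (b : ℍ[ℝ]) : ℍ[ℝ] :=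
  evalR (rmp (Ω \ {b})) b * b * (evalR (rmp (Ω \ {b})) b)⁻¹

/-- The elementary polynomial of a left node `α` that has no equivalent right node. -/
def elemL (Λ Ω : Set ℍ[ℝ]) (a c : ℍ[ℝ]) : Polynomial ℍ[ℝ] :=
  lmp (Λ \ {a}) * Polynomial.C (rhoCoeff (lmp (Λ \ {a})) (rmp Ω) a c) * rmp Ω

/-- The elementary polynomial of a right node `β` that has no equivalent left node. -/
def elemR (Λ Ω : Set ℍ[ℝ]) (b d : ℍ[ℝ]) : Polynomial ℍ[ℝ] :=
  lmp Λ * Polynomial.C (gammaCoeff (lmp Λ) (rmp (Ω \ {b})) b d) * rmp (Ω \ {b})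

/-- The quaternion `ρ` of an equivalent pair `(α, β)`. -/
def pairRho (Λ Ω : Set ℍ[ℝ]) (a b c : ℍ[ℝ]) : ℍ[ℝ] :=
  rhoCoeff (lmp (Λ \ {a})) (rmp (Ω \ {b})) a c

/-- The quaternion `γ` of an equivalent pair `(α, β)`. -/
def pairGamma (Λ Ω : Set ℍ[ℝ]) (a b d : ℍ[ℝ]) : ℍ[ℝ] :=
  gammaCoeff (lmp (Λ \ {a})) (rmp (Ω \ {b})) b d

/-- The elementary polynomial of an equivalent pair `(α, β)`:
`P_{Λ∖{α},ℓ} · ρ · P_{Ω∖{β},r} + P_{Λ,ℓ} · (2 Im α̃)⁻¹ (ρ - γ) · P_{Ω∖{β},r}`. -/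
def elemPair (Λ Ω : Set ℍ[ℝ]) (a b c d : ℍ[ℝ]) : Polynomial ℍ[ℝ] :=
  lmp (Λ \ {a}) * Polynomial.C (pairRho Λ Ω a b c) * rmp (Ω \ {b}) +
    lmp Λ * Polynomial.C ((2 * (tildeL Λ a).im)⁻¹ * (pairRho Λ Ω a b c - pairGamma Λ Ω a b d)) *
      rmp (Ω \ {b})

end

end QuatInterp

namespace QuatInterp

open Polynomial

/-! ### Evaluation -/

/-! The solution set is a particular solution plus the solutions of the homogeneous problem.

Particular solution: a factor `lmp` on the left or `rmp` on the right kills each elementary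
polynomial at every node except its own. At its own node the value is supplied by `evalL_rhoCoeff`
or `evalR_gammaCoeff`. For an equivalent pair, the second summand of `elemPair` vanishes at the left
node and corrects the right value (`evalR_elemPair`); the correction works because
`star_mul_evalL_sub_evalR` turns the compatibility of `c` and `d` into a Sylvester equation for `ρ -
γ`.

Homogeneous problem (`homogeneous_iff`): vanishing on `Ω` from the right means `f = q * rmp Ω`.
Lagrange interpolation writes `q` as a sum of terms `lmp (Λ \ {αᵢ}) * C μᵢ` modulo `lmp Λ`, and the
left value at `αᵢ` sees only the term with index `i`. If no node of `Ω` is equivalent to `αᵢ`, this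
forces `μᵢ = 0`. For a pair it says `α̃ μ = μ β̃`, whose solutions form the plane (`mem_plane_iff`).

Two devices recur. Conjugating coefficients exchanges left and right evaluation, so right-handed
facts follow from left-handed ones. Real polynomials are central and their values follow
conjugation, so a minimal polynomial dividing a real polynomial that is nonzero at `a` cannot
degenerate at `a`. -/

theorem evalR_eq_star_evalL (f : ℍ[ℝ][X]) (b : ℍ[ℝ]) :
    evalR f b = star (evalL (conjPoly f) (star b)) := by
  rw [evalL_conjPoly, star_star]

theorem conjPoly_add (f g : ℍ[ℝ][X]) : conjPoly (f + g) = conjPoly f + conjPoly g := by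
  ext1 k; simp only [coeff_conjPoly, coeff_add, star_add]

theorem conjPoly_C (q : ℍ[ℝ]) : conjPoly (C q) = C (star q) := by
  ext1 k; rw [coeff_conjPoly, coeff_C, coeff_C]; split_ifs <;> simp

theorem conjPoly_zero : conjPoly 0 = 0 := by
  ext1 k; simp [coeff_conjPoly]

theorem conjPoly_X_sub_C (q : ℍ[ℝ]) : conjPoly (X - C q) = X - C (star q) := by
  ext1 k
  rw [coeff_conjPoly, coeff_sub, coeff_sub, coeff_C, coeff_C, coeff_X, star_sub]
  split_ifs <;> simp

theorem evalR_zero (b : ℍ[ℝ]) : evalR 0 b = 0 := by simp [evalR]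

theorem evalR_add (f g : ℍ[ℝ][X]) (b : ℍ[ℝ]) : evalR (f + g) b = evalR f b + evalR g b := by
  simp only [evalR_eq_star_evalL, conjPoly_add, evalL_add, star_add]

theorem evalL_sub (f g : ℍ[ℝ][X]) (a : ℍ[ℝ]) : evalL (f - g) a = evalL f a - evalL g a := by
  rw [eq_sub_iff_add_eq, ← evalL_add, sub_add_cancel]

theorem evalR_sub (f g : ℍ[ℝ][X]) (a : ℍ[ℝ]) : evalR (f - g) a = evalR f a - evalR g a := by
  rw [eq_sub_iff_add_eq, ← evalR_add, sub_add_cancel]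

theorem evalL_sum {ι : Type*} (s : Finset ι) (f : ι → ℍ[ℝ][X]) (a : ℍ[ℝ]) :
    evalL (∑ i ∈ s, f i) a = ∑ i ∈ s, evalL (f i) a :=
  map_sum (AddMonoidHom.mk' (fun f => evalL f a) fun f g => evalL_add f g a) f s

theorem evalR_sum {ι : Type*} (s : Finset ι) (f : ι → ℍ[ℝ][X]) (a : ℍ[ℝ]) :
    evalR (∑ i ∈ s, f i) a = ∑ i ∈ s, evalR (f i) a :=
  map_sum (AddMonoidHom.mk' (fun f => evalR f a) fun f g => evalR_add f g a) f s

theorem evalL_C (q a : ℍ[ℝ]) : evalL (C q) a = q := by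
  rw [← monomial_zero_left, evalL_monomial, pow_zero, one_mul]

theorem evalR_C (q a : ℍ[ℝ]) : evalR (C q) a = q := by
  rw [evalR_eq_star_evalL, conjPoly_C, evalL_C, star_star]

theorem evalR_X_sub_C (q a : ℍ[ℝ]) : evalR (X - C q) a = a - q := by
  rw [evalR_eq_star_evalL, conjPoly_X_sub_C, evalL_X_sub_C, star_sub, star_star, star_star]

/-- The left value of a product only depends on the left value of its first factor. -/
theorem evalL_mul_eq (P g : ℍ[ℝ][X]) (a : ℍ[ℝ]) :
    evalL (P * g) a = evalL (C (evalL P a) * g) a := by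
  rw [evalL_mul, evalL_mul, evalL_C]

theorem evalR_mul_eq (P g : ℍ[ℝ][X]) (a : ℍ[ℝ]) :
    evalR (P * g) a = evalR (P * C (evalR g a)) a := by
  simp only [evalR_eq_star_evalL, conjPoly_mul, conjPoly_C, star_star]
  rw [evalL_mul_eq]

theorem evalL_mul_C (f : ℍ[ℝ][X]) (q a : ℍ[ℝ]) : evalL (f * C q) a = evalL f a * q := by
  rw [evalL_mul, sum_C_index (by simp), pow_zero, one_mul]

theorem evalR_C_mul (f : ℍ[ℝ][X]) (q a : ℍ[ℝ]) : evalR (C q * f) a = q * evalR f a := by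
  simp only [evalR_eq_star_evalL, conjPoly_mul, conjPoly_C, evalL_mul_C, star_mul, star_star]

theorem evalR_mul_of_eq_zero (P : ℍ[ℝ][X]) {g : ℍ[ℝ][X]} {a : ℍ[ℝ]} (h : evalR g a = 0) :
    evalR (P * g) a = 0 := by
  rw [evalR_mul_eq, h, C_0, mul_zero, evalR_zero]

/-- Powers of the evaluation point meet `c` first, and `a ^ k * c = c * a' ^ k`; so `c` leaves the
evaluation at the price of conjugating the point. -/
theorem evalL_C_mul_of_semiconjBy {a a' c : ℍ[ℝ]} (h : SemiconjBy c a' a) (u : ℍ[ℝ])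
    (f : ℍ[ℝ][X]) : evalL (C (c * u) * f) a = c * evalL (C u * f) a' := by
  rw [evalL_mul, evalL_mul, evalL_C, evalL_C, sum_def, sum_def, Finset.mul_sum]
  refine Finset.sum_congr rfl fun k _ => ?_
  rw [← mul_assoc, ← mul_assoc, ← mul_assoc, (h.pow_right k).eq]

theorem evalR_mul_C_of_semiconjBy {b b' d : ℍ[ℝ]} (h : SemiconjBy d b b') (u : ℍ[ℝ])
    (f : ℍ[ℝ][X]) : evalR (f * C (u * d)) b = evalR (f * C u) b' * d := by
  have h' : SemiconjBy (star d) (star b') (star b) := by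
    rw [SemiconjBy, ← star_mul, ← star_mul, h.eq]
  simp only [evalR_eq_star_evalL, conjPoly_mul, conjPoly_C, star_mul]
  rw [evalL_C_mul_of_semiconjBy h', star_mul, star_star]

/-! ### Polynomials with real coefficients -/

/-- A real polynomial regarded as a quaternionic one. -/
noncomputable def ofRealPoly (r : ℝ[X]) : ℍ[ℝ][X] := r.map (algebraMap ℝ ℍ[ℝ])

theorem evalL_ofRealPoly (r : ℝ[X]) (a : ℍ[ℝ]) : evalL (ofRealPoly r) a = aeval a r := by
  induction r using Polynomial.induction_on' with
  | add p q hp hq => rw [ofRealPoly, Polynomial.map_add, evalL_add, map_add, ← hp, ← hq]; rfl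
  | monomial n x =>
    rw [ofRealPoly, map_monomial, evalL_monomial, aeval_monomial]
    exact (Algebra.commutes x _).symm

theorem ofRealPoly_comm (r : ℝ[X]) (g : ℍ[ℝ][X]) : ofRealPoly r * g = g * ofRealPoly r := by
  ext1 k
  rw [coeff_mul, coeff_mul, ← Finset.Nat.sum_antidiagonal_swap]
  refine Finset.sum_congr rfl fun x _ => ?_
  rw [ofRealPoly, coeff_map, coeff_map]
  exact Algebra.commutes _ _

theorem conjPoly_ofRealPoly (r : ℝ[X]) : conjPoly (ofRealPoly r) = ofRealPoly r := by
  ext1 k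
  rw [coeff_conjPoly, ofRealPoly, coeff_map]
  exact Quaternion.star_coe _

theorem aeval_star (r : ℝ[X]) (a : ℍ[ℝ]) : aeval (star a) r = star (aeval a r) := by
  rw [aeval_eq_sum_range, aeval_eq_sum_range, star_sum]
  simp

theorem evalR_ofRealPoly (r : ℝ[X]) (a : ℍ[ℝ]) : evalR (ofRealPoly r) a = aeval a r := by
  rw [evalR_eq_star_evalL, conjPoly_ofRealPoly, evalL_ofRealPoly, aeval_star, star_star]

theorem evalL_ofRealPoly_mul (r : ℝ[X]) (g : ℍ[ℝ][X]) (a : ℍ[ℝ]) :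
    evalL (ofRealPoly r * g) a = aeval a r * evalL g a := by
  have h : Commute (aeval a r) a := by
    have := (Commute.all r X).map (aeval a)
    rwa [aeval_X] at this
  have := evalL_C_mul_of_semiconjBy h 1 g
  rwa [mul_one, C_1, one_mul, ← evalL_ofRealPoly, ← evalL_mul_eq, evalL_ofRealPoly] at this

theorem SemiconjBy.aeval {a a' c : ℍ[ℝ]} (h : SemiconjBy c a' a) (r : ℝ[X]) :
    SemiconjBy c (aeval a' r) (aeval a r) := by
  have := evalL_C_mul_of_semiconjBy h 1 (ofRealPoly r)
  rwa [mul_one, C_1, one_mul, ← ofRealPoly_comm, evalL_mul_C, evalL_ofRealPoly,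
    evalL_ofRealPoly, eq_comm] at this

theorem exists_ofRealPoly_of_conjPoly_eq {f : ℍ[ℝ][X]} (h : conjPoly f = f) :
    ∃ r, f = ofRealPoly r := by
  have h' : f ∈ lifts (algebraMap ℝ ℍ[ℝ]) := by
    rw [lifts_iff_coeff_lifts]
    intro k
    have hk : star (f.coeff k) = f.coeff k := by rw [← coeff_conjPoly, h]
    exact ⟨(f.coeff k).re, (Quaternion.star_eq_self.mp hk).symm⟩
  obtain ⟨r, hr⟩ := (mem_lifts _).mp h'
  exact ⟨r, hr.symm⟩

theorem exists_conjPoly_mul_self (f : ℍ[ℝ][X]) : ∃ r, conjPoly f * f = ofRealPoly r :=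
  exists_ofRealPoly_of_conjPoly_eq (by rw [conjPoly_mul, conjPoly_conjPoly])

/-- `f♯ f` is real, hence commutes with `f`; one factor `f` can then be cancelled. -/
theorem conjPoly_mul_self_comm (f : ℍ[ℝ][X]) : conjPoly f * f = f * conjPoly f := by
  rcases eq_or_ne f 0 with rfl | hf
  · rw [conjPoly_zero]
  obtain ⟨r, hr⟩ := exists_conjPoly_mul_self f
  apply mul_right_cancel₀ hf
  rw [mul_assoc f, hr, ofRealPoly_comm]

/-! ### The characteristic polynomial of a conjugacy class -/

theorem star_mul_self_comm (s : ℍ[ℝ]) : star s * s = s * star s := by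
  rw [Quaternion.self_mul_star, Quaternion.star_mul_self]

theorem mul_self_add_star_comm (s u : ℍ[ℝ]) : u * (s + star s) = (s + star s) * u := by
  rw [Quaternion.self_add_star', Quaternion.coe_commutes]

theorem mul_self_mul_star_comm (s u : ℍ[ℝ]) : u * (s * star s) = (s * star s) * u := by
  rw [Quaternion.self_mul_star, Quaternion.coe_commutes]

/-- The real quadratic polynomial with roots `s` and its conjugate. -/
noncomputable def charQuad (s : ℍ[ℝ]) : ℝ[X] :=
  X ^ 2 - C (2 * s.re) * X + C (Quaternion.normSq s)

theorem aeval_charQuad (s a : ℍ[ℝ]) :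
    aeval a (charQuad s) = a * a - a * (s + star s) + s * star s := by
  rw [Quaternion.self_add_star', Quaternion.self_mul_star, charQuad]
  rw [map_add, map_sub, map_mul, pow_two, map_mul, aeval_X, aeval_C, aeval_C, Algebra.commutes]
  rfl

theorem aeval_charQuad_self (s : ℍ[ℝ]) : aeval s (charQuad s) = 0 := by
  rw [aeval_charQuad, mul_add]; abel

theorem isConj_iff_semiconjBy {a b : ℍ[ℝ]} : IsConj a b ↔ ∃ c ≠ 0, SemiconjBy c a b :=
  ⟨fun ⟨c, hc⟩ => ⟨c, c.ne_zero, hc⟩, fun ⟨c, h0, hc⟩ => ⟨Units.mk0 c h0, hc⟩⟩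

theorem isConj_of_aeval_charQuad {s a : ℍ[ℝ]} (h : aeval a (charQuad s) = 0) : IsConj s a := by
  rw [aeval_charQuad] at h
  have hn := star_mul_self_comm s
  have hcomm := mul_self_add_star_comm s
  have hcomm' := mul_self_mul_star_comm s
  -- With `p` the characteristic quadratic of `s`, the defect of intertwining is `p(a) u`, which is
  -- zero. Any `u` giving a nonzero element proves conjugacy.
  have key : ∀ u : ℍ[ℝ], SemiconjBy (a * u - u * star s) s a := fun u => by
    have e : a * (a * u - u * star s) - (a * u - u * star s) * s
        = (a * a - a * (s + star s) + s * star s) * u := by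
      have e1 : (a * u - u * star s) * s = a * (u * (s + star s)) - a * u * star s
          - u * (s * star s) := by
        rw [← hn]; noncomm_ring
      rw [e1, hcomm, hcomm']
      noncomm_ring
    rw [h, zero_mul, sub_eq_zero] at e
    exact e.symm
  rw [isConj_iff_semiconjBy]
  by_cases hu : ∃ u, a * u - u * star s ≠ 0
  · obtain ⟨u, hu⟩ := hu
    exact ⟨_, hu, key u⟩
  · push Not at hu
    -- If every candidate vanishes, `u = 1` gives `a = star s`, and `u = i, j` show that this
    -- element commutes with `i` and `j`. It is therefore real, so `a = s`.
    have h1 : a = star s := by simpa [sub_eq_zero] using hu 1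
    obtain ⟨i, hi⟩ : ∃ i : ℍ[ℝ], i.re = 0 ∧ i.imI = 1 ∧ i.imJ = 0 ∧ i.imK = 0 :=
      ⟨⟨0, 1, 0, 0⟩, rfl, rfl, rfl, rfl⟩
    obtain ⟨j, hj⟩ : ∃ i : ℍ[ℝ], i.re = 0 ∧ i.imI = 0 ∧ i.imJ = 1 ∧ i.imK = 0 :=
      ⟨⟨0, 0, 1, 0⟩, rfl, rfl, rfl, rfl⟩
    have hI := hu i
    have hJ := hu j
    rw [h1, sub_eq_zero] at hI hJ
    have hs : a = s := by
      rw [h1, Quaternion.star_eq_self]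
      simp only [Quaternion.ext_iff, Quaternion.re_mul, Quaternion.imI_mul, Quaternion.imJ_mul,
        Quaternion.imK_mul, Quaternion.re_star, Quaternion.imI_star, Quaternion.imJ_star,
        Quaternion.imK_star, hi, hj] at hI hJ
      ext <;> simp <;> linarith
    exact ⟨1, one_ne_zero, by rw [hs]; exact SemiconjBy.one_left _⟩

theorem isConj_star_star {a b : ℍ[ℝ]} (h : IsConj a b) : IsConj (star a) (star b) := by
  obtain ⟨c, hc, h⟩ := isConj_iff_semiconjBy.mp h
  refine IsConj.symm (isConj_iff_semiconjBy.mpr ⟨star c, by simpa using hc, ?_⟩)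
  rw [SemiconjBy, ← star_mul, ← star_mul, h.eq]

/-- A real polynomial vanishing exactly on the conjugacy classes that meet `S`. -/
theorem exists_realPoly {S : Set ℍ[ℝ]} (hS : S.Finite) :
    ∃ r : ℝ[X], (∀ s ∈ S, aeval s r = 0) ∧
      ∀ a : ℍ[ℝ], (∀ s ∈ S, ¬ IsConj s a) → aeval a r ≠ 0 := by
  classical
  refine ⟨∏ s ∈ hS.toFinset, charQuad s, fun s hs => ?_, fun a ha => ?_⟩
  · rw [← Finset.mul_prod_erase _ _ (hS.mem_toFinset.mpr hs), map_mul, aeval_charQuad_self,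
      zero_mul]
  · suffices ∀ T : Finset ℍ[ℝ], (∀ s ∈ T, ¬ IsConj s a) → aeval a (∏ s ∈ T, charQuad s) ≠ 0 from
      this _ fun s hs => ha s (hS.mem_toFinset.mp hs)
    intro T
    induction T using Finset.induction_on with
    | empty => intro _; simp
    | insert b T hb ih =>
      intro h
      rw [Finset.prod_insert hb, map_mul]
      exact mul_ne_zero (fun h0 => h b (by simp) (isConj_of_aeval_charQuad h0))
        (ih fun s hs => h s (Finset.mem_insert_of_mem hs))

/-! ### Minimal polynomials -/

theorem IsLmp.evalL_eq_zero {S : Set ℍ[ℝ]} {P : ℍ[ℝ][X]} (h : IsLmp S P) {a : ℍ[ℝ]}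
    (ha : a ∈ S) : evalL P a = 0 :=
  (h.2 P).mpr ⟨1, (mul_one P).symm⟩ a ha

theorem IsRmp.evalR_eq_zero {S : Set ℍ[ℝ]} {P : ℍ[ℝ][X]} (h : IsRmp S P) {a : ℍ[ℝ]}
    (ha : a ∈ S) : evalR P a = 0 :=
  (h.2 P).mpr ⟨1, (one_mul P).symm⟩ a ha

/-- By the product rule, `P * g` vanishes at `a` exactly when `g` vanishes at `a` conjugated by the
value of `P`; one linear factor thus accounts for the new node. -/
theorem IsLmp.insert {S : Set ℍ[ℝ]} {P : ℍ[ℝ][X]} (h : IsLmp S P) {a : ℍ[ℝ]}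
    (hu : evalL P a ≠ 0) :
    IsLmp (insert a S) (P * (X - C ((evalL P a)⁻¹ * a * evalL P a))) := by
  refine ⟨h.1.mul (monic_X_sub_C _), fun f => ?_⟩
  rw [Set.forall_mem_insert, h.2]
  constructor
  · rintro ⟨h, g, rfl⟩
    rw [evalL_mul_of_ne_zero _ hu, mul_eq_zero, or_iff_right hu, evalL_eq_zero_iff] at h
    obtain ⟨q, rfl⟩ := h
    exact ⟨q, (mul_assoc _ _ _).symm⟩
  · rintro ⟨q, rfl⟩
    rw [mul_assoc]
    refine ⟨?_, _, rfl⟩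
    rw [evalL_mul_of_ne_zero _ hu, (evalL_eq_zero_iff _ _).mpr ⟨q, rfl⟩, mul_zero]

theorem IsRmp.isLmp_conjPoly {S : Set ℍ[ℝ]} {P : ℍ[ℝ][X]} (h : IsRmp S P) :
    IsLmp (star '' S) (conjPoly P) := by
  refine ⟨Monic.conjPoly h.1, fun f => ?_⟩
  have h1 : (∀ a ∈ star '' S, evalL f a = 0) ↔ ∀ b ∈ S, evalR (conjPoly f) b = 0 := by
    simp only [Set.forall_mem_image, evalR_eq_star_evalL, conjPoly_conjPoly, star_eq_zero]
  rw [h1, h.2]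
  constructor
  · rintro ⟨g, hg⟩
    exact ⟨conjPoly g, by rw [← conjPoly_mul, ← hg, conjPoly_conjPoly]⟩
  · rintro ⟨g, rfl⟩
    exact ⟨conjPoly g, by rw [conjPoly_mul, conjPoly_conjPoly]⟩

theorem IsLmp.isRmp_conjPoly {S : Set ℍ[ℝ]} {P : ℍ[ℝ][X]} (h : IsLmp (star '' S) P) :
    IsRmp S (conjPoly P) := by
  refine ⟨Monic.conjPoly h.1, fun f => ?_⟩
  have h1 : (∀ b ∈ S, evalR f b = 0) ↔ ∀ a ∈ star '' S, evalL (conjPoly f) a = 0 := by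
    simp only [Set.forall_mem_image, evalL_conjPoly, star_eq_zero]
  rw [h1, h.2]
  constructor
  · rintro ⟨g, hg⟩
    exact ⟨conjPoly g, by rw [← conjPoly_mul, ← hg, conjPoly_conjPoly]⟩
  · rintro ⟨g, rfl⟩
    exact ⟨conjPoly g, by rw [conjPoly_mul, conjPoly_conjPoly]⟩

theorem IsRmp.insert {S : Set ℍ[ℝ]} {P : ℍ[ℝ][X]} (h : IsRmp S P) {b : ℍ[ℝ]}
    (hu : evalR P b ≠ 0) :
    IsRmp (insert b S) ((X - C (evalR P b * b * (evalR P b)⁻¹)) * P) := by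
  have h' := h.isLmp_conjPoly.insert (a := star b) (by simpa [evalL_conjPoly] using hu)
  rw [← Set.image_insert_eq] at h'
  have := h'.isRmp_conjPoly
  rwa [conjPoly_mul, conjPoly_conjPoly, conjPoly_X_sub_C, evalL_conjPoly, star_mul, star_mul,
    star_inv₀, star_star, star_star, ← mul_assoc] at this

theorem lmp_eq_mul {S : Set ℍ[ℝ]} (hS : S.Finite) {a : ℍ[ℝ]} (ha : a ∈ S)
    (hu : evalL (lmp (S \ {a})) a ≠ 0) : lmp S = lmp (S \ {a}) * (X - C (tildeL S a)) := by
  refine (isLmp_lmp hS).unique ?_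
  have := (isLmp_lmp (hS.subset (Set.sdiff_subset (t := {a})))).insert hu
  rwa [Set.insert_sdiff_singleton, Set.insert_eq_of_mem ha] at this

theorem rmp_eq_mul {S : Set ℍ[ℝ]} (hS : S.Finite) {b : ℍ[ℝ]} (hb : b ∈ S)
    (hu : evalR (rmp (S \ {b})) b ≠ 0) : rmp S = (X - C (tildeR S b)) * rmp (S \ {b}) := by
  refine (isRmp_rmp hS).unique ?_
  have := (isRmp_rmp (hS.subset (Set.sdiff_subset (t := {b})))).insert hu
  rwa [Set.insert_sdiff_singleton, Set.insert_eq_of_mem hb] at this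

/-- If `P` vanished at `a`, so would every polynomial vanishing on `S`. A counterexample is a real
polynomial killing the classes of `S` other than that of `a`, times `X - C b` if `S` contains a
point `b` equivalent to `a`; by assumption there is at most one. Two equivalent points in `S` would
force vanishing on their whole class. -/
theorem IsLmp.evalL_ne_zero {S : Set ℍ[ℝ]} (hS : S.Finite) {P : ℍ[ℝ][X]} (h : IsLmp S P)
    {a : ℍ[ℝ]} (ha : a ∉ S)
    (hS2 : ∀ x ∈ S, ∀ y ∈ S, IsConj x a → IsConj y a → x = y) : evalL P a ≠ 0 := by
  intro h0
  suffices ∃ f, (∀ s ∈ S, evalL f s = 0) ∧ evalL f a ≠ 0 by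
    obtain ⟨f, hf, hfa⟩ := this
    obtain ⟨g, rfl⟩ := (h.2 f).mp hf
    exact hfa (evalL_mul_of_eq_zero g h0)
  obtain ⟨r, hr, hra⟩ := exists_realPoly (hS.subset (Set.sep_subset S fun s => ¬ IsConj s a))
  have hra := hra a fun s hs => hs.2
  by_cases hb : ∃ b ∈ S, IsConj b a
  · obtain ⟨b, hbS, hb⟩ := hb
    refine ⟨ofRealPoly r * (X - C b), fun s hs => ?_, ?_⟩
    · rw [evalL_ofRealPoly_mul, evalL_X_sub_C]
      by_cases hsa : IsConj s a
      · rw [hS2 s hs b hbS hsa hb, sub_self, mul_zero]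
      · rw [hr s ⟨hs, hsa⟩, zero_mul]
    · rw [evalL_ofRealPoly_mul, evalL_X_sub_C]
      exact mul_ne_zero hra (sub_ne_zero.mpr fun e => ha (e ▸ hbS))
  · push Not at hb
    exact ⟨ofRealPoly r, fun s hs => by rw [evalL_ofRealPoly, hr s ⟨hs, hb s hs⟩],
      by rwa [evalL_ofRealPoly]⟩

theorem IsRmp.evalR_ne_zero {S : Set ℍ[ℝ]} (hS : S.Finite) {P : ℍ[ℝ][X]} (h : IsRmp S P)
    {b : ℍ[ℝ]} (hb : b ∉ S)
    (hS2 : ∀ x ∈ S, ∀ y ∈ S, IsConj x b → IsConj y b → x = y) : evalR P b ≠ 0 := by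
  rw [evalR_eq_star_evalL, Ne, star_eq_zero]
  refine h.isLmp_conjPoly.evalL_ne_zero (hS.image _) ?_ ?_
  · rintro ⟨x, hx, e⟩
    exact hb (star_injective e ▸ hx)
  · rintro _ ⟨x, hx, rfl⟩ _ ⟨y, hy, rfl⟩ hxb hyb
    rw [hS2 x hx y hy (by simpa using isConj_star_star hxb) (by simpa using isConj_star_star hyb)]

/-! ### Nonvanishing on a conjugacy class -/

/-- Multiplying by `g` on the right preserves left vanishing and turns the value into `r(a) u`. -/
theorem eq_zero_of_evalL_C_mul {P g : ℍ[ℝ][X]} {r : ℝ[X]} (h : ofRealPoly r = P * g) {a : ℍ[ℝ]}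
    (ha : aeval a r ≠ 0) {u : ℍ[ℝ]} (hu : evalL (C u * P) a = 0) : u = 0 := by
  have := evalL_mul_of_eq_zero g hu
  rw [mul_assoc, ← h, ← ofRealPoly_comm, evalL_ofRealPoly_mul, evalL_C] at this
  exact (mul_eq_zero.mp this).resolve_left ha

theorem evalL_conjPoly_mul_self_ne_zero {P g : ℍ[ℝ][X]} {r : ℝ[X]} (h : ofRealPoly r = P * g)
    {a : ℍ[ℝ]} (ha : aeval a r ≠ 0) : evalL (conjPoly P * P) a ≠ 0 := by
  intro h0
  rw [evalL_mul_eq] at h0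
  have h1 := eq_zero_of_evalL_C_mul h ha h0
  -- Centrality of `r` allows `P` and `g` to be swapped; conjugating then shows that `P♯` is also a
  -- left factor of `r`, so its vanishing at `a` would contradict `r(a) ≠ 0`.
  have h2 : ofRealPoly r = conjPoly P * conjPoly g := by
    have hg : g ≠ 0 := by
      rintro rfl
      apply ha
      rw [← evalL_ofRealPoly, h, mul_zero, evalL_zero]
    have h3 : ofRealPoly r = g * P := by
      apply mul_right_cancel₀ hg
      rw [mul_assoc, ← h, ofRealPoly_comm]
    rw [← conjPoly_mul, ← h3, conjPoly_ofRealPoly]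
  apply ha
  rw [← evalL_ofRealPoly, h2, evalL_mul_of_eq_zero _ h1]

theorem exists_ofRealPoly_eq_lmp_mul {S : Set ℍ[ℝ]} (hS : S.Finite) {a : ℍ[ℝ]}
    (ha : ∀ s ∈ S, ¬ IsConj s a) :
    ∃ (r : ℝ[X]) (g : ℍ[ℝ][X]), ofRealPoly r = lmp S * g ∧ aeval a r ≠ 0 := by
  obtain ⟨r, hr, hra⟩ := exists_realPoly hS
  obtain ⟨g, hg⟩ := ((isLmp_lmp hS).2 (ofRealPoly r)).mp fun s hs => by
    rw [evalL_ofRealPoly, hr s hs]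
  exact ⟨r, g, hg, hra a ha⟩

theorem exists_ofRealPoly_eq_rmp_mul {S : Set ℍ[ℝ]} (hS : S.Finite) {a : ℍ[ℝ]}
    (ha : ∀ s ∈ S, ¬ IsConj s a) :
    ∃ (r : ℝ[X]) (g : ℍ[ℝ][X]), ofRealPoly r = rmp S * g ∧ aeval a r ≠ 0 := by
  obtain ⟨r, hr, hra⟩ := exists_realPoly hS
  obtain ⟨g, hg⟩ := ((isRmp_rmp hS).2 (ofRealPoly r)).mp fun s hs => by
    rw [evalR_ofRealPoly, hr s hs]
  refine ⟨r, g, mul_right_cancel₀ (isRmp_rmp hS).1.ne_zero ?_, hra a ha⟩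
  rw [mul_assoc, ← hg, ofRealPoly_comm]

/-! ### The elementary polynomials -/

/-- `P(a)⁻¹` cancels the value of `P`. Moving `N(a)⁻¹ c` out, with `N = Q♯ Q`, shifts the point to
`c⁻¹ a c`, where `Q♯` and `Q` combine to `N(c⁻¹ a c)`; since `N` is real, moving back across `c`
gives `N(a)`, which cancels. -/
theorem evalL_rhoCoeff {P Q : ℍ[ℝ][X]} {a : ℍ[ℝ]} (hP : evalL P a ≠ 0)
    (hQ : evalL (conjPoly Q * Q) a ≠ 0) (c : ℍ[ℝ]) :
    evalL (P * C (rhoCoeff P Q a c) * Q) a = c := by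
  rw [evalL_mul_eq, evalL_mul_C, rhoCoeff]
  split_ifs with hc
  · rw [mul_zero, C_0, zero_mul, evalL_zero, hc]
  have hs : SemiconjBy c (c⁻¹ * a * c) a := by
    rw [SemiconjBy, ← mul_assoc, ← mul_assoc, mul_inv_cancel₀ hc, one_mul]
  obtain ⟨r, hr⟩ := exists_conjPoly_mul_self Q
  rw [hr, evalL_ofRealPoly] at hQ
  have hN : SemiconjBy (aeval a r)⁻¹ a a := by
    have := (Commute.all r X).map (aeval a)
    rw [aeval_X] at this
    exact Commute.inv_left₀ this
  rw [hr, evalL_ofRealPoly, mul_assoc, mul_assoc, mul_inv_cancel_left₀ hP,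
    evalL_C_mul_of_semiconjBy hN, evalL_C_mul_of_semiconjBy hs, ← evalL_mul_eq, hr,
    evalL_ofRealPoly, (SemiconjBy.aeval hs r).eq, inv_mul_cancel_left₀ hQ]

theorem evalR_gammaCoeff {P Q : ℍ[ℝ][X]} {b : ℍ[ℝ]} (hQ : evalR Q b ≠ 0)
    (hP : evalL (conjPoly P * P) b ≠ 0) (d : ℍ[ℝ]) :
    evalR (P * C (gammaCoeff P Q b d) * Q) b = d := by
  rw [mul_assoc, evalR_mul_eq, evalR_C_mul, gammaCoeff]
  split_ifs with hd
  · rw [zero_mul, C_0, mul_zero, evalR_zero, hd]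
  have hs : SemiconjBy d b (d * b * d⁻¹) := by
    rw [SemiconjBy, inv_mul_cancel_right₀ hd]
  obtain ⟨r, hr⟩ := exists_conjPoly_mul_self P
  rw [hr, evalL_ofRealPoly] at hP
  have hN : SemiconjBy (aeval b r)⁻¹ b b := by
    have := (Commute.all r X).map (aeval b)
    rw [aeval_X] at this
    exact Commute.inv_left₀ this
  rw [hr, evalR_ofRealPoly, inv_mul_cancel_right₀ hQ, evalR_mul_C_of_semiconjBy hN,
    evalR_mul_C_of_semiconjBy hs, ← evalR_mul_eq, ← conjPoly_mul_self_comm, hr,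
    evalR_ofRealPoly, ← (SemiconjBy.aeval hs r).eq, mul_inv_cancel_right₀ hP]

/-- Left and right values of a polynomial at equivalent points satisfy a Sylvester equation. -/
theorem star_mul_evalL_sub_evalR {a b : ℍ[ℝ]} (h : IsConj a b) (f : ℍ[ℝ][X]) :
    star a * (evalL f a - evalR f b) = (evalL f a - evalR f b) * b := by
  obtain ⟨c, hc, hs⟩ := isConj_iff_semiconjBy.mp h
  have hb : b * b - b * (a + star a) + a * star a = 0 := by
    have := (SemiconjBy.aeval hs (charQuad a)).eq
    rw [aeval_charQuad_self, mul_zero, eq_comm, mul_eq_zero, or_iff_left hc] at this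
    rwa [← aeval_charQuad]
  have hn := star_mul_self_comm a
  have hcomm := mul_self_add_star_comm a
  have hcomm' := mul_self_mul_star_comm a
  -- The difference of the two sides is `q p(b)`, where `p` is the characteristic quadratic of `a`;
  -- it vanishes because `b` is equivalent to `a`.
  have h1 : ∀ q : ℍ[ℝ], star a * (a * q - q * b) = (a * q - q * b) * b := fun q => by
    have e : star a * (a * q - q * b) - (a * q - q * b) * b
        = (star a * a) * q - ((a + star a) * q) * b + q * (b * b) := by noncomm_ring
    rw [← sub_eq_zero, e, hn, ← hcomm', ← hcomm, mul_assoc q, ← hcomm b, ← mul_zero q, ← hb]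
    noncomm_ring
  have hmon : ∀ (k : ℕ) (q : ℍ[ℝ]), star a * (a ^ k * q - q * b ^ k)
      = (a ^ k * q - q * b ^ k) * b := by
    intro k q
    induction k with
    | zero => simp
    | succ k ih =>
      have e : a ^ (k + 1) * q - q * b ^ (k + 1)
          = a * (a ^ k * q - q * b ^ k) + (a * (q * b ^ k) - (q * b ^ k) * b) := by
        rw [pow_succ', pow_succ]; noncomm_ring
      rw [e, mul_add, add_mul, h1, ← mul_assoc, hn, mul_assoc, ih, mul_assoc a _ b]
  induction f using Polynomial.induction_on' with
  | add f g hf hg =>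
    rw [evalL_add, evalR_add, add_sub_add_comm, mul_add, add_mul, hf, hg]
  | monomial k q =>
    have e : evalR (monomial k q) b = q * b ^ k := sum_monomial_index _ _ (by simp)
    rw [evalL_monomial, e, hmon]

/-! ### The plane of solutions of a Sylvester equation -/

theorem re_eq_of_isConj {a b : ℍ[ℝ]} (h : IsConj a b) : a.re = b.re := by
  obtain ⟨c, hc, hs⟩ := isConj_iff_semiconjBy.mp h
  have h1 : b = c * a * c⁻¹ := by rw [hs.eq, mul_inv_cancel_right₀ hc]
  have h2 : ∀ x y : ℍ[ℝ], (x * y).re = (y * x).re := fun x y => by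
    simp only [Quaternion.re_mul]; ring
  rw [h1, h2, ← mul_assoc, inv_mul_cancel₀ hc, one_mul]

theorem norm_im_eq_of_isConj {a b : ℍ[ℝ]} (h : IsConj a b) : ‖a.im‖ = ‖b.im‖ := by
  obtain ⟨c, hc, hs⟩ := isConj_iff_semiconjBy.mp h
  have hs' : SemiconjBy c a.im b.im := by
    rw [← Quaternion.sub_re_self, ← Quaternion.sub_re_self, ← re_eq_of_isConj h]
    exact hs.sub_right (Quaternion.coe_commutes _ c).symm
  have := congrArg norm hs'.eq
  rw [norm_mul, norm_mul, mul_comm ‖b.im‖] at this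
  exact mul_left_cancel₀ (norm_ne_zero_iff.mpr hc) this

theorem im_ne_zero_of_isConj {a b : ℍ[ℝ]} (h : IsConj a b) (hb : b.im ≠ 0) : a.im ≠ 0 := by
  rwa [← norm_ne_zero_iff, norm_im_eq_of_isConj h, norm_ne_zero_iff]

theorem norm_smul_imUnit {a : ℍ[ℝ]} (ha : a.im ≠ 0) : ‖a.im‖ • imUnit a = a.im := by
  rw [imUnit, smul_smul, mul_inv_cancel₀ (norm_ne_zero_iff.mpr ha), one_smul]

theorem imUnit_re (a : ℍ[ℝ]) : (imUnit a).re = 0 := by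
  simp [imUnit]

theorem normSq_imUnit {a : ℍ[ℝ]} (ha : a.im ≠ 0) : Quaternion.normSq (imUnit a) = 1 := by
  rw [Quaternion.normSq_eq_norm_mul_self, imUnit, norm_smul, norm_inv, norm_norm,
    inv_mul_cancel₀ (norm_ne_zero_iff.mpr ha), one_mul]

theorem imUnit_mul_self {a : ℍ[ℝ]} (ha : a.im ≠ 0) : imUnit a * imUnit a = -1 := by
  have h : star (imUnit a) = -imUnit a := Quaternion.star_eq_neg.mpr (imUnit_re a)
  have := Quaternion.self_mul_star (imUnit a)
  rw [h, normSq_imUnit ha, Quaternion.coe_one, mul_neg] at this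
  rw [← this, neg_neg]

theorem mul_eq_mul_iff_imUnit {a b : ℍ[ℝ]} (h : IsConj a b) (ha : a.im ≠ 0) (q : ℍ[ℝ]) :
    a * q = q * b ↔ imUnit a * q = q * imUnit b := by
  have hb := im_ne_zero_of_isConj h.symm ha
  have h0 := norm_ne_zero_iff.mpr ha
  conv_lhs => rw [← Quaternion.re_add_im a, ← Quaternion.re_add_im b, ← norm_smul_imUnit ha,
    ← norm_smul_imUnit hb, ← norm_im_eq_of_isConj h, ← re_eq_of_isConj h, add_mul, mul_add,
    Quaternion.coe_commutes, add_right_inj, smul_mul_assoc, mul_smul_comm]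
  exact smul_right_inj h0

/-- The commutator is twice the cross product of the imaginary parts, so commuting means that they
are parallel; the coefficient of `I` is then the scalar product of `q` with `I`. -/
theorem mem_span_one_iff_commute {I : ℍ[ℝ]} (h0 : I.re = 0) (h1 : Quaternion.normSq I = 1)
    (q : ℍ[ℝ]) : q ∈ Submodule.span ℝ {1, I} ↔ I * q = q * I := by
  rw [Submodule.mem_span_pair]
  constructor
  · rintro ⟨x, y, rfl⟩
    simp [mul_add, add_mul]
  · intro h
    rw [Quaternion.normSq_def'] at h1
    simp only [Quaternion.ext_iff, Quaternion.re_mul, Quaternion.imI_mul, Quaternion.imJ_mul,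
      Quaternion.imK_mul, h0] at h h1
    obtain ⟨-, e1, e2, e3⟩ := h
    refine ⟨q.re, q.imI * I.imI + q.imJ * I.imJ + q.imK * I.imK, ?_⟩
    ext
    · simp [h0]
    · simp
      linear_combination (q.imI) * h1 + I.imJ / 2 * e3 - I.imK / 2 * e2
    · simp
      linear_combination (q.imJ) * h1 + I.imK / 2 * e1 - I.imI / 2 * e3
    · simp
      linear_combination (q.imK) * h1 + I.imI / 2 * e2 - I.imJ / 2 * e1

/-- `I q + q I` has real part `-2⟨I, q⟩` and imaginary part `2 Re(q) I`. -/
theorem mem_span_one_orthogonal_iff {I : ℍ[ℝ]} (h0 : I.re = 0) (h1 : Quaternion.normSq I = 1)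
    (q : ℍ[ℝ]) : q ∈ (Submodule.span ℝ {1, I})ᗮ ↔ I * q = q * -I := by
  have hmem : q ∈ (Submodule.span ℝ {1, I})ᗮ ↔ inner ℝ 1 q = 0 ∧ inner ℝ I q = 0 := by
    rw [Submodule.span_insert, ← Submodule.inf_orthogonal, Submodule.mem_inf,
      Submodule.mem_orthogonal_singleton_iff_inner_right,
      Submodule.mem_orthogonal_singleton_iff_inner_right]
  rw [hmem, Quaternion.inner_def, Quaternion.inner_def, one_mul]
  rw [Quaternion.normSq_def'] at h1
  simp only [Quaternion.ext_iff, Quaternion.re_mul, Quaternion.imI_mul, Quaternion.imJ_mul,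
    Quaternion.imK_mul, h0, Quaternion.re_star, Quaternion.imI_star, Quaternion.imJ_star,
    Quaternion.imK_star, Quaternion.re_neg, Quaternion.imI_neg, Quaternion.imJ_neg,
    Quaternion.imK_neg] at h1 ⊢
  constructor
  · rintro ⟨e0, e1⟩
    refine ⟨?_, ?_, ?_, ?_⟩
    · linear_combination -2 * e1
    · linear_combination 2 * I.imI * e0
    · linear_combination 2 * I.imJ * e0
    · linear_combination 2 * I.imK * e0
  · rintro ⟨e, e1, e2, e3⟩
    constructor
    · linear_combination I.imI / 2 * e1 + I.imJ / 2 * e2 + I.imK / 2 * e3 - q.re * h1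
    · linear_combination -e / 2

/-- The plane `Π_{a,b}` is the space of solutions of the Sylvester equation `a q = q b`. -/
theorem mem_plane_iff {a b : ℍ[ℝ]} (h : IsConj a b) (ha : a.im ≠ 0) (q : ℍ[ℝ]) :
    q ∈ plane a b ↔ a * q = q * b := by
  have hb := im_ne_zero_of_isConj h.symm ha
  rw [mul_eq_mul_iff_imUnit h ha, plane]
  split_ifs with h1 h2
  · rw [h1, mem_span_one_iff_commute (imUnit_re a) (normSq_imUnit ha)]
  · have e : imUnit b = -imUnit a := by
      rw [h2, imUnit, imUnit, Quaternion.im_star, norm_neg, smul_neg]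
    rw [e, mem_span_one_orthogonal_iff (imUnit_re a) (normSq_imUnit ha)]
  · have hI := imUnit_mul_self ha
    have hJ := imUnit_mul_self hb
    have hs : imUnit a + imUnit b ≠ 0 := by
      intro e
      apply h2
      rw [← Quaternion.re_add_im b, ← norm_smul_imUnit hb, ← norm_im_eq_of_isConj h,
        ← re_eq_of_isConj h, eq_neg_of_add_eq_zero_right e, smul_neg, norm_smul_imUnit ha]
      ext <;> simp
    -- `I + J` is one nonzero solution of `I q = q J`. Dividing any solution by it on the right
    -- gives an element commuting with `I`, that is `x + y I`; multiplying back and using `I (I + J)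
    -- = -(1 - I J)` yields the stated basis.
    have hIs : imUnit a * (imUnit a + imUnit b) = (imUnit a + imUnit b) * imUnit b := by
      rw [mul_add, add_mul, hI, hJ, add_comm]
    have hIs' : imUnit a * (imUnit a + imUnit b) = -(1 - imUnit a * imUnit b) := by
      rw [mul_add, hI]; abel
    rw [Submodule.mem_span_pair]
    constructor
    · rintro ⟨x, y, rfl⟩
      have e : imUnit a * (1 - imUnit a * imUnit b) = (1 - imUnit a * imUnit b) * imUnit b := by
        rw [← neg_inj, ← mul_neg, ← neg_mul, ← hIs', hIs, ← mul_assoc, hIs]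
      rw [mul_add, add_mul, mul_smul_comm, mul_smul_comm, smul_mul_assoc, smul_mul_assoc, hIs, e]
    · intro hq
      have hc : imUnit a * (q * (imUnit a + imUnit b)⁻¹)
          = q * (imUnit a + imUnit b)⁻¹ * imUnit a := by
        apply mul_right_cancel₀ hs
        rw [mul_assoc, mul_assoc, inv_mul_cancel₀ hs, mul_one, mul_assoc _ (imUnit a), hIs,
          ← mul_assoc _ _ (imUnit b), mul_assoc q, inv_mul_cancel₀ hs, mul_one, hq]
      rw [← mem_span_one_iff_commute (imUnit_re a) (normSq_imUnit ha),
        Submodule.mem_span_pair] at hc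
      obtain ⟨x, y, e⟩ := hc
      refine ⟨x, -y, ?_⟩
      have e' := congrArg (· * (imUnit a + imUnit b)) e
      simp only [inv_mul_cancel_right₀ hs, add_mul, smul_mul_assoc, one_mul, hIs'] at e'
      rw [← e', smul_neg, neg_smul]

/-! ### Values of the elementary polynomials -/

section Values

variable {Λ Ω : Set ℍ[ℝ]}

theorem isLmp_lmp_sdiff (hΛ : Λ.Finite) (a : ℍ[ℝ]) : IsLmp (Λ \ {a}) (lmp (Λ \ {a})) :=
  isLmp_lmp (hΛ.subset Set.sdiff_subset)

theorem isRmp_rmp_sdiff (hΩ : Ω.Finite) (b : ℍ[ℝ]) : IsRmp (Ω \ {b}) (rmp (Ω \ {b})) :=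
  isRmp_rmp (hΩ.subset Set.sdiff_subset)

theorem evalL_lmp_mul (hΛ : Λ.Finite) {a : ℍ[ℝ]} (ha : a ∈ Λ) (g : ℍ[ℝ][X]) :
    evalL (lmp Λ * g) a = 0 :=
  evalL_mul_of_eq_zero g ((isLmp_lmp hΛ).evalL_eq_zero ha)

theorem evalR_mul_rmp (hΩ : Ω.Finite) {b : ℍ[ℝ]} (hb : b ∈ Ω) (g : ℍ[ℝ][X]) :
    evalR (g * rmp Ω) b = 0 :=
  evalR_mul_of_eq_zero g ((isRmp_rmp hΩ).evalR_eq_zero hb)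

theorem evalL_lmp_sdiff_mul (hΛ : Λ.Finite) {a a' : ℍ[ℝ]} (ha' : a' ∈ Λ) (h : a' ≠ a)
    (g : ℍ[ℝ][X]) : evalL (lmp (Λ \ {a}) * g) a' = 0 :=
  evalL_lmp_mul (hΛ.subset Set.sdiff_subset) ⟨ha', h⟩ g

theorem evalR_mul_rmp_sdiff (hΩ : Ω.Finite) {b b' : ℍ[ℝ]} (hb' : b' ∈ Ω) (h : b' ≠ b)
    (g : ℍ[ℝ][X]) : evalR (g * rmp (Ω \ {b})) b' = 0 :=
  evalR_mul_rmp (hΩ.subset Set.sdiff_subset) ⟨hb', h⟩ g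

theorem evalL_conjPoly_lmp_mul_self_ne_zero (hΛ : Λ.Finite) {a : ℍ[ℝ]}
    (ha : ∀ s ∈ Λ, ¬ IsConj s a) : evalL (conjPoly (lmp Λ) * lmp Λ) a ≠ 0 := by
  obtain ⟨r, g, h, h0⟩ := exists_ofRealPoly_eq_lmp_mul hΛ ha
  exact evalL_conjPoly_mul_self_ne_zero h h0

theorem evalL_conjPoly_rmp_mul_self_ne_zero (hΩ : Ω.Finite) {a : ℍ[ℝ]}
    (ha : ∀ s ∈ Ω, ¬ IsConj s a) : evalL (conjPoly (rmp Ω) * rmp Ω) a ≠ 0 := by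
  obtain ⟨r, g, h, h0⟩ := exists_ofRealPoly_eq_rmp_mul hΩ ha
  exact evalL_conjPoly_mul_self_ne_zero h h0

theorem eq_zero_of_evalL_C_mul_rmp (hΩ : Ω.Finite) {a : ℍ[ℝ]} (ha : ∀ s ∈ Ω, ¬ IsConj s a)
    {u : ℍ[ℝ]} (hu : evalL (C u * rmp Ω) a = 0) : u = 0 := by
  obtain ⟨r, g, h, h0⟩ := exists_ofRealPoly_eq_rmp_mul hΩ ha
  exact eq_zero_of_evalL_C_mul h h0 hu

theorem evalL_elemL (hΩ : Ω.Finite) {a : ℍ[ℝ]} (hu : evalL (lmp (Λ \ {a})) a ≠ 0)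
    (ha : ∀ s ∈ Ω, ¬ IsConj s a) (c : ℍ[ℝ]) : evalL (elemL Λ Ω a c) a = c :=
  evalL_rhoCoeff hu (evalL_conjPoly_rmp_mul_self_ne_zero hΩ ha) c

theorem evalR_elemR (hΛ : Λ.Finite) {b : ℍ[ℝ]} (hu : evalR (rmp (Ω \ {b})) b ≠ 0)
    (hb : ∀ s ∈ Λ, ¬ IsConj s b) (d : ℍ[ℝ]) : evalR (elemR Λ Ω b d) b = d :=
  evalR_gammaCoeff hu (evalL_conjPoly_lmp_mul_self_ne_zero hΛ hb) d

theorem evalL_elemPair (hΛ : Λ.Finite) (hΩ : Ω.Finite) {a b : ℍ[ℝ]} (haΛ : a ∈ Λ)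
    (hu : evalL (lmp (Λ \ {a})) a ≠ 0) (ha : ∀ s ∈ Ω \ {b}, ¬ IsConj s a) (c d : ℍ[ℝ]) :
    evalL (elemPair Λ Ω a b c d) a = c := by
  rw [elemPair, evalL_add, mul_assoc (lmp Λ), evalL_lmp_mul hΛ haΛ, add_zero]
  exact evalL_rhoCoeff hu
    (evalL_conjPoly_rmp_mul_self_ne_zero (hΩ.subset Set.sdiff_subset) ha) c

theorem evalL_elemPair_of_ne (hΛ : Λ.Finite) {a a' : ℍ[ℝ]} (ha' : a' ∈ Λ) (h : a' ≠ a)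
    (b c d : ℍ[ℝ]) : evalL (elemPair Λ Ω a b c d) a' = 0 := by
  rw [elemPair, evalL_add, mul_assoc, mul_assoc (lmp Λ), evalL_lmp_mul hΛ ha',
    evalL_lmp_sdiff_mul hΛ ha' h, add_zero]

theorem evalR_elemPair_of_ne (hΩ : Ω.Finite) {b b' : ℍ[ℝ]} (hb' : b' ∈ Ω) (h : b' ≠ b)
    (a c d : ℍ[ℝ]) : evalR (elemPair Λ Ω a b c d) b' = 0 := by
  rw [elemPair, evalR_add, evalR_mul_rmp_sdiff hΩ hb' h, evalR_mul_rmp_sdiff hΩ hb' h, add_zero]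

theorem isConj_tildeL {a : ℍ[ℝ]} (hu : evalL (lmp (Λ \ {a})) a ≠ 0) : IsConj (tildeL Λ a) a :=
  isConj_iff_semiconjBy.mpr ⟨_, hu, by
    rw [SemiconjBy, tildeL, ← mul_assoc, ← mul_assoc, mul_inv_cancel₀ hu, one_mul]⟩

theorem isConj_tildeR {b : ℍ[ℝ]} (hu : evalR (rmp (Ω \ {b})) b ≠ 0) : IsConj b (tildeR Ω b) :=
  isConj_iff_semiconjBy.mpr ⟨_, hu, by rw [SemiconjBy, tildeR, inv_mul_cancel_right₀ hu]⟩

theorem evalL_mul_tildeL {a : ℍ[ℝ]} (hu : evalL (lmp (Λ \ {a})) a ≠ 0) :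
    evalL (lmp (Λ \ {a})) a * tildeL Λ a = a * evalL (lmp (Λ \ {a})) a := by
  rw [tildeL, ← mul_assoc, ← mul_assoc, mul_inv_cancel₀ hu, one_mul]

theorem evalL_mul_star_tildeL {a : ℍ[ℝ]} (hu : evalL (lmp (Λ \ {a})) a ≠ 0) :
    evalL (lmp (Λ \ {a})) a * star (tildeL Λ a) = star a * evalL (lmp (Λ \ {a})) a := by
  -- Equivalent elements share their real part, so an intertwining relation passes to the
  -- conjugates.
  have e : ∀ x : ℍ[ℝ], star x = ((2 * x.re : ℝ) : ℍ[ℝ]) - x := fun x => by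
    rw [← Quaternion.self_add_star', add_sub_cancel_left]
  rw [e a, e, re_eq_of_isConj (isConj_tildeL hu), mul_sub, sub_mul, evalL_mul_tildeL hu,
    Quaternion.coe_commutes]

theorem tildeR_mul_evalR {b : ℍ[ℝ]} (hu : evalR (rmp (Ω \ {b})) b ≠ 0) :
    tildeR Ω b * evalR (rmp (Ω \ {b})) b = evalR (rmp (Ω \ {b})) b * b := by
  rw [tildeR, inv_mul_cancel_right₀ hu]

/-- The Sylvester equation for the difference of the coefficients of an equivalent pair. -/
theorem star_tildeL_mul_pairRho_sub_pairGamma (hΛ : Λ.Finite) (hΩ : Ω.Finite) {a b c d : ℍ[ℝ]}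
    (hab : IsConj a b)
    (hu : evalL (lmp (Λ \ {a})) a ≠ 0) (hv : evalR (rmp (Ω \ {b})) b ≠ 0)
    (ha : ∀ s ∈ Ω \ {b}, ¬ IsConj s a) (hb : ∀ s ∈ Λ \ {a}, ¬ IsConj s b)
    (hcd : star a * (c - d) = (c - d) * b) :
    star (tildeL Λ a) * (pairRho Λ Ω a b c - pairGamma Λ Ω a b d) =
      (pairRho Λ Ω a b c - pairGamma Λ Ω a b d) * tildeR Ω b := by
  have hρ : evalL (lmp (Λ \ {a}) * C (pairRho Λ Ω a b c) * rmp (Ω \ {b})) a = c :=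
    evalL_rhoCoeff hu (evalL_conjPoly_rmp_mul_self_ne_zero (hΩ.subset Set.sdiff_subset) ha) c
  have hγ : evalR (lmp (Λ \ {a}) * C (pairGamma Λ Ω a b d) * rmp (Ω \ {b})) b = d :=
    evalR_gammaCoeff hv (evalL_conjPoly_lmp_mul_self_ne_zero (hΛ.subset Set.sdiff_subset) hb) d
  have h1 := star_mul_evalL_sub_evalR hab
    (lmp (Λ \ {a}) * C (pairRho Λ Ω a b c) * rmp (Ω \ {b}))
  rw [hρ] at h1
  have h2 := star_mul_evalL_sub_evalR hab
    (lmp (Λ \ {a}) * C ((pairRho Λ Ω a b c - pairGamma Λ Ω a b d) * evalR (rmp (Ω \ {b})) b))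
  set P := lmp (Λ \ {a})
  set Q := rmp (Ω \ {b})
  set ρ := pairRho Λ Ω a b c
  set γ := pairGamma Λ Ω a b d
  have h3 : evalR (P * C ((ρ - γ) * evalR Q b)) b = evalR (P * C ρ * Q) b - d := by
    rw [← evalR_C_mul, ← evalR_mul_eq, ← mul_assoc, C_sub, mul_sub, sub_mul, evalR_sub, hγ]
  -- Subtracting the Sylvester equation of `P ρ Q` from the compatibility of `c` and `d` gives this
  -- equation for a right value. By `h2` the left value `P(a) (ρ - γ) Q(b)` satisfies it too, and
  -- moving `P(a)` and `Q(b)` across puts the tildes on `a` and `b`.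
  have h4 : star a * evalR (P * C ((ρ - γ) * evalR Q b)) b =
      evalR (P * C ((ρ - γ) * evalR Q b)) b * b := by
    rw [h3, ← sub_sub_sub_cancel_left _ _ c, mul_sub, sub_mul, hcd, h1]
  rw [mul_sub (star a), sub_mul (evalL _ a), h4, sub_left_inj, evalL_mul_C, ← mul_assoc,
    ← evalL_mul_star_tildeL hu] at h2
  apply mul_left_cancel₀ hu
  apply mul_right_cancel₀ hv
  calc _ = _ := by simp only [mul_assoc, P]
    _ = _ := h2
    _ = _ := by simp only [mul_assoc, tildeR_mul_evalR hv, Q]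

theorem evalR_elemPair (hΛ : Λ.Finite) (hΩ : Ω.Finite) {a b c d : ℍ[ℝ]} (haΛ : a ∈ Λ)
    (hab : IsConj a b) (hb0 : b.im ≠ 0)
    (hu : evalL (lmp (Λ \ {a})) a ≠ 0) (hv : evalR (rmp (Ω \ {b})) b ≠ 0)
    (ha : ∀ s ∈ Ω \ {b}, ¬ IsConj s a) (hb : ∀ s ∈ Λ \ {a}, ¬ IsConj s b)
    (hcd : star a * (c - d) = (c - d) * b) :
    evalR (elemPair Λ Ω a b c d) b = d := by
  have hγ : evalR (lmp (Λ \ {a}) * C (pairGamma Λ Ω a b d) * rmp (Ω \ {b})) b = d :=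
    evalR_gammaCoeff hv (evalL_conjPoly_lmp_mul_self_ne_zero (hΛ.subset Set.sdiff_subset) hb) d
  have hδ := star_tildeL_mul_pairRho_sub_pairGamma hΛ hΩ hab hu hv ha hb hcd
  have him : (tildeL Λ a).im ≠ 0 := im_ne_zero_of_isConj ((isConj_tildeL hu).trans hab) hb0
  have h2im : 2 * (tildeL Λ a).im = tildeL Λ a - star (tildeL Λ a) := by
    rw [two_mul]
    ext <;> simp
  have h2 : 2 * (tildeL Λ a).im ≠ 0 := by
    rw [two_mul, ← two_smul ℝ]
    exact smul_ne_zero two_ne_zero him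
  rw [elemPair, lmp_eq_mul hΛ haΛ hu]
  set A := tildeL Λ a
  set ρ := pairRho Λ Ω a b c
  set γ := pairGamma Λ Ω a b d
  set w := (2 * A.im)⁻¹ * (ρ - γ) with hw
  have hcomm : Commute (2 * A.im)⁻¹ (star A) := by
    apply Commute.inv_left₀
    rw [h2im]
    refine Commute.sub_left ?_ (Commute.refl _)
    exact (star_mul_self_comm A).symm
  -- By `hδ`, the factor `β̃` on the right of `ρ - γ` becomes `star A` on the left; what remains is
  -- `A - star A = 2 Im A`, inverted by the scalar in `w`.
  have hwA : A * w - w * tildeR Ω b = ρ - γ := by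
    rw [hw, mul_assoc _ _ (tildeR Ω b), ← hδ, ← mul_assoc, ← mul_assoc, hcomm.eq, ← sub_mul,
      ← sub_mul, ← h2im, mul_inv_cancel₀ h2, one_mul]
  -- The factor `X - C A` contributes `(w β̃ - A w) Q(b)`, with `Q = rmp (Ω \ {b})`, which by `hwA`
  -- replaces `ρ` by `γ`.
  have hval : evalR (C ρ * rmp (Ω \ {b}) + (X - C A) * C w * rmp (Ω \ {b})) b =
      evalR (C γ * rmp (Ω \ {b})) b := by
    have hx : evalR ((X - C A) * C (w * evalR (rmp (Ω \ {b})) b)) b =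
        w * evalR (rmp (Ω \ {b})) b * b - A * (w * evalR (rmp (Ω \ {b})) b) := by
      rw [sub_mul, evalR_sub, ← C_mul, evalR_C, X_mul_C, evalR_C_mul, ← sub_zero X, ← C_0,
        evalR_X_sub_C, sub_zero]
    rw [evalR_add, mul_assoc, evalR_mul_eq (X - C A), evalR_C_mul, evalR_C_mul, evalR_C_mul, hx,
      mul_assoc w, ← tildeR_mul_evalR hv, ← mul_assoc, ← mul_assoc, ← sub_mul, ← add_mul,
      ← neg_sub, hwA]
    congr 1
    abel
  have e : lmp (Λ \ {a}) * C ρ * rmp (Ω \ {b}) +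
      lmp (Λ \ {a}) * (X - C A) * C w * rmp (Ω \ {b}) =
      lmp (Λ \ {a}) * (C ρ * rmp (Ω \ {b}) + (X - C A) * C w * rmp (Ω \ {b})) := by
    simp only [mul_add, mul_assoc]
  rw [e, evalR_mul_eq, hval, ← evalR_mul_eq, ← mul_assoc, hγ]

/-- The left value at `a` of `P_{Λ∖{a}} μ P_Ω` vanishes exactly when `μ` solves the Sylvester
equation of the pair `(a, b)`. -/
theorem evalL_lmp_mul_C_mul_rmp_eq_zero_iff (hΩ : Ω.Finite) {a b : ℍ[ℝ]} (hbΩ : b ∈ Ω)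
    (hu : evalL (lmp (Λ \ {a})) a ≠ 0) (hv : evalR (rmp (Ω \ {b})) b ≠ 0)
    (ha : ∀ s ∈ Ω \ {b}, ¬ IsConj s a) (μ : ℍ[ℝ]) :
    evalL (lmp (Λ \ {a}) * C μ * rmp Ω) a = 0 ↔ tildeL Λ a * μ = μ * tildeR Ω b := by
  have hx : evalL (C (evalL (lmp (Λ \ {a})) a * μ) * (X - C (tildeR Ω b))) a =
      evalL (lmp (Λ \ {a})) a * (tildeL Λ a * μ - μ * tildeR Ω b) := by
    rw [mul_sub, evalL_sub, ← C_mul, evalL_C, ← X_mul_C, evalL_mul_C, ← sub_zero X, ← C_0,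
      evalL_X_sub_C, sub_zero, mul_sub, ← mul_assoc _ (tildeL Λ a), evalL_mul_tildeL hu]
    simp only [mul_assoc]
  have key : evalL (lmp (Λ \ {a}) * C μ * rmp Ω) a =
      evalL (C (evalL (lmp (Λ \ {a})) a * (tildeL Λ a * μ - μ * tildeR Ω b)) * rmp (Ω \ {b})) a := by
    rw [evalL_mul_eq, evalL_mul_C, rmp_eq_mul hΩ hbΩ hv, ← mul_assoc, evalL_mul_eq, hx]
  rw [key, ← sub_eq_zero (a := tildeL Λ a * μ)]
  constructor
  · intro h
    exact (mul_eq_zero.mp (eq_zero_of_evalL_C_mul_rmp (hΩ.subset Set.sdiff_subset) ha h)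
      ).resolve_left hu
  · intro h
    rw [h, mul_zero, C_0, zero_mul, evalL_zero]

theorem eq_zero_of_evalL_lmp_mul_C_mul_rmp (hΩ : Ω.Finite) {a : ℍ[ℝ]}
    (hu : evalL (lmp (Λ \ {a})) a ≠ 0) (ha : ∀ s ∈ Ω, ¬ IsConj s a) {μ : ℍ[ℝ]}
    (h : evalL (lmp (Λ \ {a}) * C μ * rmp Ω) a = 0) : μ = 0 := by
  rw [evalL_mul_eq, evalL_mul_C] at h
  exact (mul_eq_zero.mp (eq_zero_of_evalL_C_mul_rmp hΩ ha h)).resolve_left hu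

/-- Left Lagrange interpolation. -/
theorem exists_eq_sum_add_lmp_mul {n : ℕ} {α : Fin n → ℍ[ℝ]} (hα : Function.Injective α)
    (hu : ∀ i, evalL (lmp (Set.range α \ {α i})) (α i) ≠ 0) (q : ℍ[ℝ][X]) :
    ∃ (μ : Fin n → ℍ[ℝ]) (h : ℍ[ℝ][X]),
      q = ∑ i, lmp (Set.range α \ {α i}) * C (μ i) + lmp (Set.range α) * h := by
  -- These coefficients make the sum agree with `q` at every node, so the difference is a right
  -- multiple of the minimal polynomial.
  refine ⟨fun i => (evalL (lmp (Set.range α \ {α i})) (α i))⁻¹ * evalL q (α i), ?_⟩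
  simp only [← sub_eq_iff_eq_add']
  rw [← (isLmp_lmp (Set.finite_range α)).2]
  rintro _ ⟨i, rfl⟩
  rw [evalL_sub, evalL_sum, Finset.sum_eq_single i, evalL_mul_C, mul_inv_cancel_left₀ (hu i),
    sub_self]
  · intro j _ hj
    exact evalL_lmp_sdiff_mul (Set.finite_range α) ⟨i, rfl⟩ (hα.ne hj.symm) _
  · simp

theorem sum_castLE_add_sum_filter {M : Type*} [AddCommMonoid M] {k n : ℕ} (h : k ≤ n)
    (g : Fin n → M) :
    ∑ i, g i = ∑ s : Fin k, g (s.castLE h) + ∑ i : Fin n with k ≤ i.val, g i := by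
  have e : ∑ s : Fin k, g (s.castLE h) = ∑ i : Fin n with ¬ k ≤ i.val, g i := by
    refine Finset.sum_bij (fun s _ => s.castLE h) (fun s _ => by simp)
      (fun s _ t _ hst => Fin.castLE_injective h hst) (fun i hi => ?_) (fun _ _ => rfl)
    exact ⟨⟨i, by simpa using hi⟩, Finset.mem_univ _, rfl⟩
  rw [e, add_comm, Finset.sum_filter_add_sum_filter_not]

end Values

end QuatInterp

open QuatInterp in
/-- The homogeneous problem. -/
theorem QuatInterp.homogeneous_iff {n m k : ℕ} (hkn : k ≤ n) (hkm : k ≤ m)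
    {α : Fin n → ℍ[ℝ]} {β : Fin m → ℍ[ℝ]} (hα : Function.Injective α)
    (hu : ∀ i, evalL (lmp (Set.range α \ {α i})) (α i) ≠ 0)
    (hv : ∀ j, evalR (rmp (Set.range β \ {β j})) (β j) ≠ 0)
    (hpair : ∀ s : Fin k, IsConj (α (s.castLE hkn)) (β (s.castLE hkm)))
    (hreal : ∀ s : Fin k, (β (s.castLE hkm)).im ≠ 0)
    (hfree : ∀ i : Fin n, k ≤ i.val → ∀ b ∈ Set.range β, ¬ IsConj b (α i))
    (hfree' : ∀ s : Fin k, ∀ b ∈ Set.range β \ {β (s.castLE hkm)},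
      ¬ IsConj b (α (s.castLE hkn)))
    (f : Polynomial ℍ[ℝ]) :
    ((∀ i, evalL f (α i) = 0) ∧ (∀ j, evalR f (β j) = 0)) ↔
      ∃ (μ : Fin k → ℍ[ℝ]) (h : Polynomial ℍ[ℝ]),
        (∀ s : Fin k, μ s ∈ plane (tildeL (Set.range α) (α (s.castLE hkn)))
          (tildeR (Set.range β) (β (s.castLE hkm)))) ∧
        f = ∑ s : Fin k, lmp (Set.range α \ {α (s.castLE hkn)}) *
              Polynomial.C (μ s) * rmp (Set.range β)
          + lmp (Set.range α) * h * rmp (Set.range β) := by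
  have hΛ := Set.finite_range α
  have hΩ := Set.finite_range β
  -- Both sides express `α̃ μ = μ β̃`; nonreality passes from `β` to `α̃` along their equivalence.
  have hplane : ∀ (s : Fin k) (μ : ℍ[ℝ]),
      μ ∈ plane (tildeL (Set.range α) (α (s.castLE hkn)))
        (tildeR (Set.range β) (β (s.castLE hkm))) ↔
      evalL (lmp (Set.range α \ {α (s.castLE hkn)}) * Polynomial.C μ * rmp (Set.range β))
        (α (s.castLE hkn)) = 0 := fun s μ => by
    have h1 := (isConj_tildeL (hu (s.castLE hkn))).trans (hpair s)
    rw [mem_plane_iff (h1.trans (isConj_tildeR (hv (s.castLE hkm))))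
      (im_ne_zero_of_isConj h1 (hreal s)),
      evalL_lmp_mul_C_mul_rmp_eq_zero_iff hΩ ⟨_, rfl⟩ (hu _) (hv _) (hfree' s)]
  constructor
  · rintro ⟨hL, hR⟩
    obtain ⟨q, rfl⟩ := ((isRmp_rmp hΩ).2 f).mp (by rintro _ ⟨j, rfl⟩; exact hR j)
    obtain ⟨μ, h, rfl⟩ := exists_eq_sum_add_lmp_mul hα hu q
    have hμ : ∀ i, evalL (lmp (Set.range α \ {α i}) * Polynomial.C (μ i) * rmp (Set.range β))
        (α i) = 0 := fun i => by
      have := hL i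
      rw [add_mul, Finset.sum_mul, evalL_add, mul_assoc (lmp _) h, evalL_lmp_mul hΛ ⟨i, rfl⟩,
        add_zero, evalL_sum, Finset.sum_eq_single i] at this
      · exact this
      · intro j _ hj
        rw [mul_assoc]
        exact evalL_lmp_sdiff_mul hΛ ⟨i, rfl⟩ (hα.ne hj.symm) _
      · simp
    refine ⟨fun s => μ (s.castLE hkn), h, fun s => (hplane s _).mpr (hμ _), ?_⟩
    rw [add_mul, Finset.sum_mul, sum_castLE_add_sum_filter hkn]
    rw [Finset.sum_eq_zero (s := Finset.univ.filter _), add_zero]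
    intro i hi
    rw [eq_zero_of_evalL_lmp_mul_C_mul_rmp hΩ (hu i) (hfree i (by simpa using hi)) (hμ i),
      Polynomial.C_0, mul_zero, zero_mul]
  · rintro ⟨μ, h, hμ, rfl⟩
    constructor
    · intro i
      rw [evalL_add, mul_assoc (lmp _) h, evalL_lmp_mul hΛ ⟨i, rfl⟩, add_zero, evalL_sum]
      refine Finset.sum_eq_zero fun s _ => ?_
      by_cases hs : i = s.castLE hkn
      · rw [hs]
        exact (hplane s _).mp (hμ s)
      · rw [mul_assoc]
        exact evalL_lmp_sdiff_mul hΛ ⟨i, rfl⟩ (hα.ne hs) _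
    · intro j
      rw [evalR_add, evalR_mul_rmp hΩ ⟨j, rfl⟩, add_zero, evalR_sum]
      exact Finset.sum_eq_zero fun s _ => evalR_mul_rmp hΩ ⟨j, rfl⟩ _

/-! ### The particular solution and the general solution -/

theorem theoremT (n m k : ℕ) (hkn : k ≤ n) (hkm : k ≤ m)
    (α c : Fin n → ℍ[ℝ]) (β d : Fin m → ℍ[ℝ])
    (hα : Function.Injective α) (hβ : Function.Injective β)
    -- no three of the `n + m` interpolation nodes are equivalent
    (hA : ∀ x y z : Fin n ⊕ Fin m, x ≠ y → y ≠ z → x ≠ z →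
      ¬ (IsConj (Sum.elim α β x) (Sum.elim α β y) ∧ IsConj (Sum.elim α β y) (Sum.elim α β z)))
    -- the equivalent pairs in `Λ × Ω` are those with a common index `s < k`
    (hpair : ∀ s : Fin k, IsConj (α (s.castLE hkn)) (β (s.castLE hkm)))
    (hαΩ : ∀ i : Fin n, k ≤ i.val → ∀ j : Fin m, ¬ IsConj (α i) (β j))
    (hβΛ : ∀ j : Fin m, k ≤ j.val → ∀ i : Fin n, ¬ IsConj (β j) (α i))
    -- nodes of equivalent pairs are not real
    (hreal : ∀ s : Fin k, (β (s.castLE hkm)).im ≠ 0)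
    -- compatibility of the target values
    (hcd : ∀ s : Fin k, star (α (s.castLE hkn)) * (c (s.castLE hkn) - d (s.castLE hkm)) =
      (c (s.castLE hkn) - d (s.castLE hkm)) * β (s.castLE hkm))
    (f : Polynomial ℍ[ℝ]) :
    ((∀ i, QuatInterp.evalL f (α i) = c i) ∧ (∀ j, QuatInterp.evalR f (β j) = d j)) ↔
      ∃ (μ : Fin k → ℍ[ℝ]) (h : Polynomial ℍ[ℝ]),
        (∀ s : Fin k, μ s ∈ QuatInterp.plane
          (QuatInterp.tildeL (Set.range α) (α (s.castLE hkn)))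
          (QuatInterp.tildeR (Set.range β) (β (s.castLE hkm)))) ∧
        f = ∑ i : Fin n with k ≤ i.val,
              QuatInterp.elemL (Set.range α) (Set.range β) (α i) (c i)
          + ∑ j : Fin m with k ≤ j.val,
              QuatInterp.elemR (Set.range α) (Set.range β) (β j) (d j)
          + ∑ s : Fin k, QuatInterp.elemPair (Set.range α) (Set.range β)
              (α (s.castLE hkn)) (β (s.castLE hkm)) (c (s.castLE hkn)) (d (s.castLE hkm))
          + ∑ s : Fin k, QuatInterp.lmp (Set.range α \ {α (s.castLE hkn)}) *
              Polynomial.C (μ s) * QuatInterp.rmp (Set.range β)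
          + QuatInterp.lmp (Set.range α) * h * QuatInterp.rmp (Set.range β) := by
  have hΛ := Set.finite_range α
  have hΩ := Set.finite_range β
  have hu : ∀ i, QuatInterp.evalL (QuatInterp.lmp (Set.range α \ {α i})) (α i) ≠ 0 := by
    intro i
    refine (QuatInterp.isLmp_lmp_sdiff hΛ _).evalL_ne_zero (hΛ.subset Set.sdiff_subset)
      (by simp) ?_
    rintro _ ⟨⟨x, rfl⟩, hx⟩ _ ⟨⟨y, rfl⟩, hy⟩ hxi hyi
    by_contra hxy
    exact hA (.inl x) (.inl i) (.inl y) (by rintro ⟨⟩; exact hx rfl)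
      (by rintro ⟨⟩; exact hy rfl) (by rintro ⟨⟩; exact hxy rfl) ⟨hxi, hyi.symm⟩
  have hv : ∀ j, QuatInterp.evalR (QuatInterp.rmp (Set.range β \ {β j})) (β j) ≠ 0 := by
    intro j
    refine (QuatInterp.isRmp_rmp_sdiff hΩ _).evalR_ne_zero (hΩ.subset Set.sdiff_subset)
      (by simp) ?_
    rintro _ ⟨⟨x, rfl⟩, hx⟩ _ ⟨⟨y, rfl⟩, hy⟩ hxj hyj
    by_contra hxy
    exact hA (.inr x) (.inr j) (.inr y) (by rintro ⟨⟩; exact hx rfl)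
      (by rintro ⟨⟩; exact hy rfl) (by rintro ⟨⟩; exact hxy rfl) ⟨hxj, hyj.symm⟩
  have hfreeL : ∀ i : Fin n, k ≤ i.val → ∀ b ∈ Set.range β, ¬ IsConj b (α i) := by
    rintro i hi _ ⟨j, rfl⟩ h
    exact hαΩ i hi j h.symm
  have hfreeR : ∀ j : Fin m, k ≤ j.val → ∀ a ∈ Set.range α, ¬ IsConj a (β j) := by
    rintro j hj _ ⟨i, rfl⟩ h
    exact hβΛ j hj i h.symm
  have hpairL : ∀ s : Fin k, ∀ b ∈ Set.range β \ {β (s.castLE hkm)},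
      ¬ IsConj b (α (s.castLE hkn)) := by
    rintro s _ ⟨⟨j, rfl⟩, hj⟩ h
    exact hA (.inr j) (.inl (s.castLE hkn)) (.inr (s.castLE hkm)) (by simp) (by simp)
      (by rintro ⟨⟩; exact hj rfl) ⟨h, hpair s⟩
  have hpairR : ∀ s : Fin k, ∀ a ∈ Set.range α \ {α (s.castLE hkn)},
      ¬ IsConj a (β (s.castLE hkm)) := by
    rintro s _ ⟨⟨i, rfl⟩, hi⟩ h
    exact hA (.inl i) (.inr (s.castLE hkm)) (.inl (s.castLE hkn)) (by simp) (by simp)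
      (by rintro ⟨⟩; exact hi rfl) ⟨h, (hpair s).symm⟩
  set f₀ : Polynomial ℍ[ℝ] := ∑ i : Fin n with k ≤ i.val,
              QuatInterp.elemL (Set.range α) (Set.range β) (α i) (c i)
          + ∑ j : Fin m with k ≤ j.val,
              QuatInterp.elemR (Set.range α) (Set.range β) (β j) (d j)
          + ∑ s : Fin k, QuatInterp.elemPair (Set.range α) (Set.range β)
              (α (s.castLE hkn)) (β (s.castLE hkm)) (c (s.castLE hkn)) (d (s.castLE hkm)) with hf₀
  have hL₀ : ∀ i, QuatInterp.evalL f₀ (α i) = c i := by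
    intro i
    -- The trivial last branch lets this be stated for all indices. With `h2`, the paired and
    -- unpaired contributions form a single Kronecker delta over all left nodes.
    have h1 : ∀ i', QuatInterp.evalL
        (QuatInterp.elemL (Set.range α) (Set.range β) (α i') (c i')) (α i) =
          if k ≤ i'.val then (if i' = i then c i else 0) else QuatInterp.evalL
        (QuatInterp.elemL (Set.range α) (Set.range β) (α i') (c i')) (α i) := by
      intro i'
      split_ifs with hk h
      · rw [h, QuatInterp.evalL_elemL hΩ (hu i) (hfreeL i (h ▸ hk))]
      · rw [QuatInterp.elemL, mul_assoc]
        exact QuatInterp.evalL_lmp_sdiff_mul hΛ ⟨i, rfl⟩ (hα.ne (Ne.symm h)) _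
      · rfl
    have h2 : ∀ s : Fin k, QuatInterp.evalL (QuatInterp.elemPair (Set.range α) (Set.range β)
        (α (s.castLE hkn)) (β (s.castLE hkm)) (c (s.castLE hkn)) (d (s.castLE hkm))) (α i) =
          if s.castLE hkn = i then c i else 0 := by
      intro s
      split_ifs with h
      · rw [← h, QuatInterp.evalL_elemPair hΛ hΩ ⟨_, rfl⟩ (hu _) (hpairL s)]
      · exact QuatInterp.evalL_elemPair_of_ne hΛ ⟨i, rfl⟩ (hα.ne (Ne.symm h)) _ _ _
    rw [hf₀, QuatInterp.evalL_add, QuatInterp.evalL_add, QuatInterp.evalL_sum,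
      QuatInterp.evalL_sum, QuatInterp.evalL_sum,
      Finset.sum_congr rfl (fun s _ => h2 s),
      Finset.sum_eq_zero (s := Finset.univ.filter fun j : Fin m => k ≤ j.val), add_zero, add_comm,
      Finset.sum_congr rfl (g := fun i' => if i' = i then c i else 0),
      ← QuatInterp.sum_castLE_add_sum_filter hkn (fun i' => if i' = i then c i else 0)]
    · simp
    · intro i' hi'
      rw [h1, if_pos (by simpa using hi')]
    · intro j _
      rw [QuatInterp.elemR, mul_assoc]
      exact QuatInterp.evalL_lmp_mul hΛ ⟨i, rfl⟩ _
  have hR₀ : ∀ j, QuatInterp.evalR f₀ (β j) = d j := by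
    intro j
    have h1 : ∀ j', QuatInterp.evalR
        (QuatInterp.elemR (Set.range α) (Set.range β) (β j') (d j')) (β j) =
          if k ≤ j'.val then (if j' = j then d j else 0) else QuatInterp.evalR
        (QuatInterp.elemR (Set.range α) (Set.range β) (β j') (d j')) (β j) := by
      intro j'
      split_ifs with hk h
      · rw [h, QuatInterp.evalR_elemR hΛ (hv j) (hfreeR j (h ▸ hk))]
      · exact QuatInterp.evalR_mul_rmp_sdiff hΩ ⟨j, rfl⟩ (hβ.ne (Ne.symm h)) _
      · rfl
    have h2 : ∀ s : Fin k, QuatInterp.evalR (QuatInterp.elemPair (Set.range α) (Set.range β)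
        (α (s.castLE hkn)) (β (s.castLE hkm)) (c (s.castLE hkn)) (d (s.castLE hkm))) (β j) =
          if s.castLE hkm = j then d j else 0 := by
      intro s
      split_ifs with h
      · rw [← h, QuatInterp.evalR_elemPair hΛ hΩ ⟨_, rfl⟩ (hpair s) (hreal s) (hu _) (hv _)
          (hpairL s) (hpairR s) (hcd s)]
      · exact QuatInterp.evalR_elemPair_of_ne hΩ ⟨j, rfl⟩ (hβ.ne (Ne.symm h)) _ _ _
    rw [hf₀, QuatInterp.evalR_add, QuatInterp.evalR_add, QuatInterp.evalR_sum,
      QuatInterp.evalR_sum, QuatInterp.evalR_sum,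
      Finset.sum_congr rfl (fun s _ => h2 s),
      Finset.sum_eq_zero (s := Finset.univ.filter fun i : Fin n => k ≤ i.val), zero_add, add_comm,
      Finset.sum_congr rfl (g := fun j' => if j' = j then d j else 0),
      ← QuatInterp.sum_castLE_add_sum_filter hkm (fun j' => if j' = j then d j else 0)]
    · simp
    · intro j' hj'
      rw [h1, if_pos (by simpa using hj')]
    · intro i _
      exact QuatInterp.evalR_mul_rmp hΩ ⟨j, rfl⟩ _
  -- Since `f₀` has the prescribed values, `f` interpolates exactly when `f - f₀` solves the
  -- homogeneous problem.
  have key := QuatInterp.homogeneous_iff hkn hkm hα hu hv hpair hreal hfreeL hpairL (f - f₀)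
  simp only [QuatInterp.evalL_sub, QuatInterp.evalR_sub, hL₀, hR₀, sub_eq_zero] at key
  rw [key]
  simp only [sub_eq_iff_eq_add', ← add_assoc]
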